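/- For $r\ge 0$ let $V_0=\mathbb C^r$ be an $r$-dimensional purely even (parafermionic) space with standard basis $a_1^\dagger,\dots,a_r^\dagger$. Its creation parastatistics algebra is $$PS(V_0)=T(V_0)/\bigl([V_0,[V_0,V_0]]\bigr),$$ the quotient of the tensor algebra by the two-sided ideal generated by all double commutators of elements of $V_0$. (For a superspace $V$, $PS(V)$ is defined in the same way with supercommutators; for an even space these are commutators.) The symmetric group $\mathfrak S_r$ acts on $PS(V_0)$ by the algebra automorphisms $\sigma\cdot a_i^\dagger=a_{\sigma(i)}^\dagger$. Let $PS(r)$ be the multilinear part of $PS(V_0)$, that is, the $\mathfrak S_r$-stable linear span of the monomials $a_{\tau(1)}^\dagger a_{\tau(2)}^\dagger\cdots a_{\tau(r)}^\dagger$, $\tau\in\mathfrak S_r$. For a partition $\lambda\vdash r$ let $S^\lambda$ be the Specht module of $\mathfrak S_r$ over $\mathbb C$, that is, the span of the polytabloids of shape $\lambda$ (so that $S^{(r)}$ is the trivial module). **Lemma.** For every $r\ge 0$ the modules $S^\lambda$, $\lambda\vdash r$, are irreducible, and there is an isomorphism of $\mathfrak S_r$-modules $$PS(r)\;\cong\;\bigoplus_{\lambda\vdash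 r}S^\lambda .$$ Consequently the $\mathfrak S$-module $PS=\bigoplus_{r\ge0}PS(r)$ contains each irreducible module exactly once: for every $r\geq 0$, every irreducible finite-dimensional $\mathbb C[\mathfrak S_r]$-module is isomorphic to $S^\lambda$ for exactly one $\lambda\vdash r$, and $PS(r)$ has exactly one submodule isomorphic to it. -/

import Mathlib

namespace Parastatistics

section Algebra

/-- The supercommutator `⟦x, y⟧ = x y - (-1)^{i j} y x` of two elements `x`, `y` of an algebra,
where `x` is regarded as homogeneous of parity `i` and `y` as homogeneous of parity `j`. -/
def superComm {A : Type*} [Ring A] (i j : ZMod 2) (x y : A) : A :=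
  x * y - (-1) ^ (i.val * j.val) * (y * x)

/-- The relations of the creation parastatistics algebra of a vector superspace `V` with
homogeneous parts `𝒱 0` (even) and `𝒱 1` (odd): every double supercommutator `⟦x, ⟦y, z⟧⟧` of
homogeneous vectors `x, y, z` of `V` vanishes. By trilinearity, these elements span
`⟦V, ⟦V, V⟧⟧`. -/
inductive PSRel {V : Type*} [AddCommGroup V] [Module ℂ V] (𝒱 : ZMod 2 → Submodule ℂ V) :
    TensorAlgebra ℂ V → TensorAlgebra ℂ V → Prop
  | double_superComm {i j k : ZMod 2} {x y z : V} (hx : x ∈ 𝒱 i) (hy : y ∈ 𝒱 j) (hz : z ∈ 𝒱 k) :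
      PSRel 𝒱 (superComm i (j + k) (TensorAlgebra.ι ℂ x)
        (superComm j k (TensorAlgebra.ι ℂ y) (TensorAlgebra.ι ℂ z))) 0

/-- The creation parastatistics algebra `PS(V)`: the quotient of the tensor algebra `T(V)` by the
two-sided ideal generated by the double supercommutators `⟦V, ⟦V, V⟧⟧`. -/
abbrev PS {V : Type*} [AddCommGroup V] [Module ℂ V] (𝒱 : ZMod 2 → Submodule ℂ V) : Type _ :=
  RingQuot (PSRel 𝒱)

/-- The creation operator attached to a vector of `V`, i.e. its image in `PS(V)`. -/
noncomputable def creation {V : Type*} [AddCommGroup V] [Module ℂ V]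
    (𝒱 : ZMod 2 → Submodule ℂ V) : V →ₗ[ℂ] PS 𝒱 :=
  (RingQuot.mkAlgHom ℂ (PSRel 𝒱)).toLinearMap ∘ₗ TensorAlgebra.ι ℂ

theorem superComm_map {A B : Type*} [Ring A] [Ring B] [Algebra ℂ A] [Algebra ℂ B]
    (f : A →ₐ[ℂ] B) (i j : ZMod 2) (x y : A) :
    f (superComm i j x y) = superComm i j (f x) (f y) := by
  simp [superComm]

theorem creation_rel {V : Type*} [AddCommGroup V] [Module ℂ V] (𝒱 : ZMod 2 → Submodule ℂ V)
    {i j k : ZMod 2} {x y z : V} (hx : x ∈ 𝒱 i) (hy : y ∈ 𝒱 j) (hz : z ∈ 𝒱 k) :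
    superComm i (j + k) (creation 𝒱 x) (superComm j k (creation 𝒱 y) (creation 𝒱 z)) = 0 := by
  have h := RingQuot.mkAlgHom_rel ℂ (PSRel.double_superComm hx hy hz)
  simpa [superComm_map, creation] using h

/-- Functoriality: an even linear map `V → W` of superspaces induces an algebra homomorphism
`PS(V) → PS(W)`. -/
noncomputable def PS.map {V W : Type*} [AddCommGroup V] [Module ℂ V] [AddCommGroup W] [Module ℂ W]
    {𝒱 : ZMod 2 → Submodule ℂ V} {𝒲 : ZMod 2 → Submodule ℂ W} (f : V →ₗ[ℂ] W)
    (hf : ∀ i, ∀ x ∈ 𝒱 i, f x ∈ 𝒲 i) : PS 𝒱 →ₐ[ℂ] PS 𝒲 :=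
  RingQuot.liftAlgHom ℂ ⟨TensorAlgebra.lift ℂ (creation 𝒲 ∘ₗ f), by
    rintro _ _ ⟨hx, hy, hz⟩
    simp only [superComm_map, TensorAlgebra.lift_ι_apply, LinearMap.comp_apply, map_zero]
    exact creation_rel 𝒲 (hf _ _ hx) (hf _ _ hy) (hf _ _ hz)⟩

@[simp]
theorem PS.map_creation {V W : Type*} [AddCommGroup V] [Module ℂ V] [AddCommGroup W] [Module ℂ W]
    {𝒱 : ZMod 2 → Submodule ℂ V} {𝒲 : ZMod 2 → Submodule ℂ W} (f : V →ₗ[ℂ] W)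
    (hf : ∀ i, ∀ x ∈ 𝒱 i, f x ∈ 𝒲 i) (x : V) :
    PS.map f hf (creation 𝒱 x) = creation 𝒲 (f x) := by
  simp [PS.map, creation]

theorem PS.hom_ext {V A : Type*} [AddCommGroup V] [Module ℂ V] [Ring A] [Algebra ℂ A]
    {𝒱 : ZMod 2 → Submodule ℂ V} {f g : PS 𝒱 →ₐ[ℂ] A}
    (h : ∀ x, f (creation 𝒱 x) = g (creation 𝒱 x)) : f = g := by
  apply RingQuot.ringQuot_ext'
  apply TensorAlgebra.hom_ext
  ext x
  exact h x

end Algebra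

section MultilinearPart

/-- The grading of a purely even superspace `V = V₀`. -/
def evenGrading (V : Type*) [AddCommGroup V] [Module ℂ V] : ZMod 2 → Submodule ℂ V :=
  fun i => if i = 0 then ⊤ else ⊥

theorem map_evenGrading {V W : Type*} [AddCommGroup V] [Module ℂ V] [AddCommGroup W] [Module ℂ W]
    (f : V →ₗ[ℂ] W) (i : ZMod 2) (x : V) (hx : x ∈ evenGrading V i) : f x ∈ evenGrading W i := by
  unfold evenGrading at *
  split_ifs at * with h
  · trivial
  · simp_all

/-- The creation parastatistics algebra `PS(V₀)` of the even space `V₀ = ℂ^r` (parafermions). -/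
abbrev PSEven (r : ℕ) : Type :=
  PS (evenGrading (Fin r → ℂ))

/-- The generator `a_i†` of `PS(ℂ^r)`. -/
noncomputable def gen {r : ℕ} (i : Fin r) : PSEven r :=
  creation (evenGrading (Fin r → ℂ)) (Pi.single i 1)

/-- The action of the symmetric group `𝔖_r` on `PS(ℂ^r)` by algebra automorphisms: `σ` acts by
functoriality through the permutation matrix `v ↦ v ∘ σ⁻¹` of `ℂ^r`, so that
`σ · a_i† = a_{σ i}†`. -/
noncomputable def permRep (r : ℕ) : Representation ℂ (Equiv.Perm (Fin r)) (PSEven r) where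
  toFun σ := (PS.map (LinearMap.funLeft ℂ ℂ (σ⁻¹ : Equiv.Perm (Fin r)))
    (map_evenGrading _)).toLinearMap
  map_one' := by
    have : PS.map (LinearMap.funLeft ℂ ℂ ((1 : Equiv.Perm (Fin r))⁻¹ : Equiv.Perm (Fin r)))
        (map_evenGrading _) = AlgHom.id ℂ (PSEven r) := by
      apply PS.hom_ext
      intro x
      simp only [PS.map_creation, AlgHom.id_apply]
      rfl
    rw [this]; rfl
  map_mul' σ τ := by
    have : PS.map (LinearMap.funLeft ℂ ℂ ((σ * τ)⁻¹ : Equiv.Perm (Fin r))) (map_evenGrading _) =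
        (PS.map (LinearMap.funLeft ℂ ℂ (σ⁻¹ : Equiv.Perm (Fin r))) (map_evenGrading _)).comp
          (PS.map (𝒲 := evenGrading (Fin r → ℂ))
            (LinearMap.funLeft ℂ ℂ (τ⁻¹ : Equiv.Perm (Fin r))) (map_evenGrading _)) := by
      apply PS.hom_ext
      intro x
      simp only [PS.map_creation, AlgHom.comp_apply, mul_inv_rev]
      rfl
    rw [this]; rfl

theorem permRep_gen {r : ℕ} (σ : Equiv.Perm (Fin r)) (i : Fin r) :
    permRep r σ (gen i) = gen (σ i) := by
  have : LinearMap.funLeft ℂ ℂ (σ⁻¹ : Equiv.Perm (Fin r)) (Pi.single i 1) =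
      Pi.single (σ i) (1 : ℂ) := by
    ext j
    simp [LinearMap.funLeft_apply, Pi.single_apply, Equiv.symm_apply_eq]
  simp only [permRep, gen, MonoidHom.coe_mk, OneHom.coe_mk, AlgHom.toLinearMap_apply,
    PS.map_creation, this]

/-- The multilinear monomial `a_{τ 1}† a_{τ 2}† ⋯ a_{τ r}†` of `PS(ℂ^r)`. -/
noncomputable def multilinearMonomial {r : ℕ} (τ : Equiv.Perm (Fin r)) : PSEven r :=
  (List.ofFn fun i => gen (τ i)).prod

theorem permRep_multilinearMonomial {r : ℕ} (σ τ : Equiv.Perm (Fin r)) :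
    permRep r σ (multilinearMonomial τ) = multilinearMonomial (σ * τ) := by
  have h : ∀ i, permRep r σ (gen i) = gen (σ i) := permRep_gen σ
  simp only [permRep, MonoidHom.coe_mk, OneHom.coe_mk, AlgHom.toLinearMap_apply] at h
  simp only [permRep, MonoidHom.coe_mk, OneHom.coe_mk, AlgHom.toLinearMap_apply,
    multilinearMonomial, map_list_prod, List.map_ofFn, Function.comp_def, h,
    Equiv.Perm.mul_apply]

/-- The multilinear part `PS(r)` of `PS(ℂ^r)`: the span of all monomials in which each of the `r`
generators occurs exactly once, a subrepresentation of `𝔖_r`. -/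
noncomputable def multilinearPart (r : ℕ) : Subrepresentation (permRep r) where
  toSubmodule := Submodule.span ℂ (Set.range multilinearMonomial)
  apply_mem_toSubmodule σ v hv := by
    refine (Submodule.map_span_le (permRep r σ) _ _).2 ?_ (Submodule.mem_map_of_mem hv)
    rintro _ ⟨τ, rfl⟩
    rw [permRep_multilinearMonomial]
    exact Submodule.subset_span ⟨_, rfl⟩

end MultilinearPart

section Specht

/-- The partitions `λ ⊢ r`, given by their Young diagrams. -/
abbrev PartitionOf (r : ℕ) : Type :=
  {μ : YoungDiagram // μ.card = r}

/-- A Young tableau of shape `μ ⊢ r`: a filling of the `r` cells of `μ` with the `r` letters of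
`Fin r`, recorded as the bijection sending a letter to its cell `(row, column)`. -/
abbrev Tableau {r : ℕ} (μ : PartitionOf r) : Type :=
  Fin r ≃ μ.1.cells

/-- The tabloid of a tableau `T` (the class of `T` modulo permutations of the letters within the
rows), recorded as the function sending a letter to the index of the row containing it. -/
def tabloid {r : ℕ} {μ : PartitionOf r} (T : Tableau μ) : Fin r → ℕ :=
  fun i => (T i).1.1

/-- The tableau `σ T`, in which every letter `i` of `T` is replaced by `σ i`. -/
def Tableau.perm {r : ℕ} {μ : PartitionOf r} (σ : Equiv.Perm (Fin r)) (T : Tableau μ) :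
    Tableau μ :=
  σ.symm.trans T

/-- The column stabilizer of a tableau `T`: the permutations of the letters preserving the set of
letters of each column of `T`. -/
def columnStabilizer {r : ℕ} {μ : PartitionOf r} (T : Tableau μ) :
    Finset (Equiv.Perm (Fin r)) :=
  {q | ∀ i, (T (q i)).1.2 = (T i).1.2}

/-- The permutation representation of `𝔖_r` on formal linear combinations of functions
`f : Fin r → ℕ` (assignments of the letters to rows): `σ · f = f ∘ σ⁻¹`. The tabloids of shape `μ`
span in it the permutation module `M^μ`. -/
noncomputable def rowRep (r : ℕ) :
    Representation ℂ (Equiv.Perm (Fin r)) ((Fin r → ℕ) →₀ ℂ) where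
  toFun σ := Finsupp.lmapDomain ℂ ℂ (fun f => f ∘ (σ⁻¹ : Equiv.Perm (Fin r)))
  map_one' := by ext; simp
  map_mul' σ τ := by ext; simp [Function.comp_assoc]

/-- The polytabloid `e_T = ∑_{q ∈ C_T} sgn(q) {q T}`. -/
noncomputable def polytabloid {r : ℕ} {μ : PartitionOf r} (T : Tableau μ) :
    (Fin r → ℕ) →₀ ℂ :=
  ∑ q ∈ columnStabilizer T,
    Finsupp.single (tabloid (T.perm q)) ((Equiv.Perm.sign q : ℤ) : ℂ)

theorem rowRep_polytabloid {r : ℕ} {μ : PartitionOf r} (σ : Equiv.Perm (Fin r)) (T : Tableau μ) :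
    rowRep r σ (polytabloid T) = polytabloid (T.perm σ) := by
  simp only [polytabloid, map_sum]
  refine Finset.sum_bij' (fun q _ => σ * q * σ⁻¹) (fun q _ => σ⁻¹ * q * σ) ?_ ?_ ?_ ?_ ?_
  · intro q hq
    simp only [columnStabilizer, Finset.mem_filter, Finset.mem_univ, true_and] at hq ⊢
    intro i
    have := hq (σ.symm i)
    simpa [Tableau.perm, Equiv.Perm.inv_def] using this
  · intro q hq
    simp only [columnStabilizer, Finset.mem_filter, Finset.mem_univ, true_and] at hq ⊢
    intro i
    have := hq (σ i)
    simpa [Tableau.perm, Equiv.Perm.inv_def] using this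
  · intro q _; group
  · intro q _; group
  · intro q _
    simp only [rowRep, MonoidHom.coe_mk, OneHom.coe_mk, Finsupp.lmapDomain_apply,
      Finsupp.mapDomain_single]
    congr 1
    · ext i
      have h : (σ * q * σ⁻¹).symm i = σ (q.symm (σ.symm i)) := rfl
      simp [tabloid, Tableau.perm, h]
    · simp [mul_right_comm]

/-- The Specht module `S^μ`: the span of the polytabloids of all tableaux of shape `μ`. -/
noncomputable def specht {r : ℕ} (μ : PartitionOf r) : Subrepresentation (rowRep r) where
  toSubmodule := Submodule.span ℂ (Set.range fun T : Tableau μ => polytabloid T)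
  apply_mem_toSubmodule σ v hv := by
    refine (Submodule.map_span_le (rowRep r σ) _ _).2 ?_ (Submodule.mem_map_of_mem hv)
    rintro _ ⟨T, rfl⟩
    rw [rowRep_polytabloid]
    exact Submodule.subset_span ⟨_, rfl⟩

end Specht

end Parastatistics

/-!
The multilinear part `PS(r)` is shown to contain every irreducible representation of `𝔖_r` exactly
once, by comparing a lower bound for each multiplicity with an upper bound for the dimension.

*Specht modules.* James's argument applies: the column antisymmetrizer of a tableau `T` kills an
assignment of the letters to rows unless it separates the letters of each column of `T`, and an
assignment that does so dominates a column rearrangement of `T` (`exists_tabloid_le`). Hence it maps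
`S^μ` to the line of the polytabloid of `T`, which together with the nondegeneracy of the invariant
form on `S^μ` gives irreducibility (`isIrreducible_specht`), and a nonzero map between two Specht
modules forces a dominance relation between the shapes, so that different shapes give
nonisomorphic modules (`eq_of_equiv_specht`). There are as many shapes as conjugacy classes, so by
orthogonality of characters the Specht modules are all the irreducible modules
(`exists_equiv_of_isIrreducible`).

*Every `S^μ` is a quotient of `PS(r)`.* In Green's ansatz a parafermionic creation operator is a sum
of fermionic ones, one for each column of `μ`, operators of different columns commuting with each
other. Such operators on a Fock space with one mode for each cell of `μ` satisfy the relations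
`[V, [V, V]] = 0`. Letting the letter `i` act through the modes of the row `f i`, and
taking the matrix coefficient between the vacuum and the state in which all modes are occupied,
gives for each `f` a functional on `PS(r)`; as `f` varies these combine to an equivariant map into
the span of the tabloids. Its value at the monomial `a_1† ⋯ a_r†` is a signed sum of tabloids over
all tableaux of shape `μ`. This vector is a combination of polytabloids, and it does not vanish,
because at a weakly increasing `f` no cancellation takes place (`spechtVector_mem`,
`spechtVector_ne_zero`, `toSpecht_ne_zero`).

*Dimensions.* Since commutators of letters are central, `PS(r)` is spanned by products of commutators
and of single letters in a fixed order, that is, by one element for each involution in `𝔖_r`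
(`finrank_multilinearPart_le`). On the other hand every `S^μ` carries an invariant symmetric form,
so that the theorem of Frobenius and Schur says that the dimensions of the Specht modules add up to
the number of involutions (`sum_finrank_eq_card_involutions`). The joint map from `PS(r)` to the
direct sum of the Specht modules is surjective, hence bijective.
-/

namespace Parastatistics

/-! ### Characters of finite groups -/

section Characters

open Representation

variable {G : Type*} [Group G]

theorem exists_eq_smul_id {V : Type*} [AddCommGroup V] [Module ℂ V]
    [FiniteDimensional ℂ V] (ρ : Representation ℂ G V) [ρ.IsIrreducible] (f : V →ₗ[ℂ] V)
    (hf : ∀ g, f ∘ₗ ρ g = ρ g ∘ₗ f) : ∃ c : ℂ, f = c • LinearMap.id := by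
  obtain ⟨c, hc⟩ := (IsIrreducible.algebraMap_intertwiningMap_bijective_of_isAlgClosed
    (k := ℂ) (ρ := ρ)).2 ⟨f, hf⟩
  refine ⟨c, ?_⟩
  have := congrArg IntertwiningMap.toLinearMap hc
  exact this.symm

theorem finrank_pos_of_isIrreducible {V : Type*} [AddCommGroup V] [Module ℂ V]
    [FiniteDimensional ℂ V] (ρ : Representation ℂ G V) [ρ.IsIrreducible] :
    0 < Module.finrank ℂ V := by
  rw [Module.finrank_pos_iff]
  by_contra h
  rw [not_nontrivial_iff_subsingleton] at h
  apply bot_ne_top (α := Subrepresentation ρ)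
  apply Subrepresentation.toSubmodule_injective
  exact Subsingleton.elim _ _

/-- The character of a representation, as a function on conjugacy classes. -/
noncomputable def classCharacter {V : Type*} [AddCommGroup V] [Module ℂ V]
    (ρ : Representation ℂ G V) : ConjClasses G → ℂ :=
  Quotient.lift ρ.character fun a b (h : IsConj a b) => by
    obtain ⟨c, rfl⟩ := isConj_iff.1 h
    rw [char_conj]

theorem classCharacter_mk {V : Type*} [AddCommGroup V] [Module ℂ V] (ρ : Representation ℂ G V)
    (g : G) : classCharacter ρ (ConjClasses.mk g) = ρ.character g := rfl

variable [Fintype G]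

/-- The operator `∑ g, χ_σ(g⁻¹) ρ(g)` attached to the character of `σ`. Up to a scalar this is the
projection of `ρ` onto its `σ`-isotypic part. -/
noncomputable def charOperator {V W : Type*} [AddCommGroup V] [Module ℂ V] [AddCommGroup W]
    [Module ℂ W] (σ : Representation ℂ G W) (ρ : Representation ℂ G V) : V →ₗ[ℂ] V :=
  ∑ g : G, σ.character g⁻¹ • ρ g

theorem charOperator_comp {V W : Type*} [AddCommGroup V] [Module ℂ V] [AddCommGroup W]
    [Module ℂ W] (σ : Representation ℂ G W) (ρ : Representation ℂ G V) (h : G) :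
    charOperator σ ρ ∘ₗ ρ h = ρ h ∘ₗ charOperator σ ρ := by
  rw [charOperator, ← Module.End.mul_eq_comp, ← Module.End.mul_eq_comp, Finset.sum_mul,
    Finset.mul_sum]
  refine Fintype.sum_equiv (MulAut.conj h⁻¹).toEquiv _ _ fun g => ?_
  have h1 : σ.character (h⁻¹ * g * h)⁻¹ = σ.character g⁻¹ := by
    rw [← char_conj σ g⁻¹ h⁻¹]
    group
  have h2 : ρ g ∘ₗ ρ h = ρ h ∘ₗ ρ (h⁻¹ * g * h) := by
    rw [← Module.End.mul_eq_comp, ← Module.End.mul_eq_comp, ← map_mul, ← map_mul]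
    group
  change σ.character g⁻¹ • ρ g ∘ₗ ρ h = ρ h ∘ₗ (σ.character (h⁻¹ * g * h⁻¹⁻¹)⁻¹ •
    ρ (h⁻¹ * g * h⁻¹⁻¹))
  rw [inv_inv, h1, h2, LinearMap.comp_smul]

/-- An intertwining map commutes with the operators attached to a character. -/
theorem map_charOperator {U V W : Type*} [AddCommGroup U] [Module ℂ U] [AddCommGroup V]
    [Module ℂ V] [AddCommGroup W] [Module ℂ W] (σ : Representation ℂ G W)
    {ρ : Representation ℂ G V} {τ : Representation ℂ G U} (f : IntertwiningMap ρ τ) (v : V) :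
    f (charOperator σ ρ v) = charOperator σ τ (f v) := by
  simp [charOperator, LinearMap.sum_apply, map_sum, f.isIntertwining]

theorem charOperator_eq_zero {V W : Type*} [AddCommGroup V] [Module ℂ V] [FiniteDimensional ℂ V]
    [AddCommGroup W] [Module ℂ W] [FiniteDimensional ℂ W] (σ : Representation ℂ G W)
    (ρ : Representation ℂ G V) [ρ.IsIrreducible] [σ.IsIrreducible]
    (h : IsEmpty (σ.Equiv ρ)) : charOperator σ ρ = 0 := by
  classical
  obtain ⟨c, hc⟩ := exists_eq_smul_id ρ _ (charOperator_comp σ ρ)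
  have : Invertible (Nat.card G : ℂ) := invertibleOfNonzero (by simp)
  have ho := char_orthonormal ρ σ
  rw [if_neg (not_nonempty_iff.2 h)] at ho
  have ht : LinearMap.trace ℂ V (charOperator σ ρ) = 0 := by
    have : ∑ g : G, ρ.character g * σ.character g⁻¹ = 0 := by simpa using ho
    rw [← this, charOperator, map_sum]
    exact Finset.sum_congr rfl fun g _ => by simp [character, mul_comm]
  rw [hc] at ht ⊢
  have hd := finrank_pos_of_isIrreducible ρ
  simp only [map_smul, LinearMap.trace_id, smul_eq_mul, mul_eq_zero, Nat.cast_eq_zero] at ht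
  rcases ht with rfl | ht
  · simp
  · omega

theorem charOperator_self {W : Type*} [AddCommGroup W] [Module ℂ W] [FiniteDimensional ℂ W]
    (σ : Representation ℂ G W) [σ.IsIrreducible] :
    ∃ c : ℂ, c ≠ 0 ∧ charOperator σ σ = c • LinearMap.id := by
  classical
  obtain ⟨c, hc⟩ := exists_eq_smul_id σ _ (charOperator_comp σ σ)
  refine ⟨c, ?_, hc⟩
  rintro rfl
  have : Invertible (Nat.card G : ℂ) := invertibleOfNonzero (by simp)
  have ho := char_orthonormal σ σ
  rw [if_pos ⟨Representation.Equiv.refl σ⟩] at ho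
  have : ∑ g : G, σ.character g * σ.character g⁻¹ = 0 := by
    have ht : LinearMap.trace ℂ W (charOperator σ σ) = 0 := by simp [hc]
    rw [← ht, charOperator, map_sum]
    exact Finset.sum_congr rfl fun g _ => by simp [character, mul_comm]
  simp [this] at ho

/-- Averaging the rank one operators `v ↦ B(y, v) x` over the group. -/
theorem sum_form_mul_form {V : Type*} [AddCommGroup V] [Module ℂ V] [FiniteDimensional ℂ V]
    (ρ : Representation ℂ G V) [ρ.IsIrreducible] (B : LinearMap.BilinForm ℂ V) (x y z v : V) :
    Module.finrank ℂ V * ∑ g : G, B y (ρ g⁻¹ v) * B z (ρ g x) =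
      Fintype.card G * (B y x * B z v) := by
  let X : V →ₗ[ℂ] V := (B y).smulRight x
  let A : V →ₗ[ℂ] V := ∑ g : G, ρ g ∘ₗ X ∘ₗ ρ g⁻¹
  have hA : ∀ h, A ∘ₗ ρ h = ρ h ∘ₗ A := by
    intro h
    rw [← Module.End.mul_eq_comp, ← Module.End.mul_eq_comp, Finset.sum_mul, Finset.mul_sum]
    refine Fintype.sum_equiv (Equiv.mulLeft h⁻¹) _ _ fun g => ?_
    ext u
    simp only [LinearMap.comp_apply, Equiv.coe_mulLeft,  mul_inv_rev, inv_inv, map_mul,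
      Module.End.mul_apply]
    rw [← Module.End.mul_apply (ρ h), ← map_mul]
    simp
  obtain ⟨c, hc⟩ := exists_eq_smul_id ρ A hA
  have ht : c * Module.finrank ℂ V = Fintype.card G * B y x := by
    have h1 : LinearMap.trace ℂ V A = c * Module.finrank ℂ V := by simp [hc]
    rw [← h1, map_sum]
    have h2 : ∀ g : G, LinearMap.trace ℂ V (ρ g ∘ₗ X ∘ₗ ρ g⁻¹) = B y x := by
      intro g
      rw [LinearMap.trace_comp_comm', LinearMap.comp_assoc, ← Module.End.mul_eq_comp (ρ g⁻¹),
        ← map_mul]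
      simp [X, Module.End.one_eq_id]
    simp [h2]
  have hz : B z (A v) = ∑ g : G, B y (ρ g⁻¹ v) * B z (ρ g x) := by
    simp [A, X, LinearMap.sum_apply, map_sum]
  rw [← hz, hc]
  simp only [LinearMap.smul_apply, LinearMap.id_apply, map_smul, smul_eq_mul]
  linear_combination B z v * ht

/-- The Frobenius–Schur indicator of an irreducible representation with an invariant
nondegenerate symmetric bilinear form is `1`. -/
theorem sum_character_mul_self {V : Type*} [AddCommGroup V] [Module ℂ V] [FiniteDimensional ℂ V]
    (ρ : Representation ℂ G V) [ρ.IsIrreducible] (B : LinearMap.BilinForm ℂ V)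
    (hB : B.Nondegenerate) (hs : ∀ x y, B x y = B y x)
    (hinv : ∀ g x y, B (ρ g x) (ρ g y) = B x y) :
    ∑ g : G, ρ.character (g * g) = Fintype.card G := by
  classical
  -- the coordinates in the basis `b` are given by the form, so that `ρ g⁻¹` is the adjoint of `ρ g`
  let b' := Module.finBasis ℂ V
  let b := B.dualBasis hB b'
  have hrepr : ∀ v i, b.repr v i = B (b' i) v := fun v i => by
    rw [LinearMap.BilinForm.dualBasis_repr_apply, hs]
  have htr : ∀ g, ρ.character (g * g) =
      ∑ i, ∑ j, B (b j) (ρ g⁻¹ (b' i)) * B (b' j) (ρ g (b i)) := by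
    intro g
    rw [character, LinearMap.trace_eq_matrix_trace ℂ b, map_mul, LinearMap.toMatrix_mul,
      Matrix.trace]
    refine Finset.sum_congr rfl fun i _ => ?_
    rw [Matrix.diag_apply, Matrix.mul_apply]
    refine Finset.sum_congr rfl fun j _ => ?_
    rw [LinearMap.toMatrix_apply, LinearMap.toMatrix_apply, hrepr, hrepr]
    congr 1
    rw [hs, ← hinv g⁻¹]
    simp [← Module.End.mul_apply, ← map_mul]
  have hd := finrank_pos_of_isIrreducible ρ
  have hd' : (Module.finrank ℂ V : ℂ) ≠ 0 := by exact_mod_cast hd.ne'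
  apply mul_left_cancel₀ hd'
  have key : ∀ i, ∑ j, (Module.finrank ℂ V : ℂ) *
      ∑ g : G, B (b j) (ρ g⁻¹ (b' i)) * B (b' j) (ρ g (b i)) = Fintype.card G := by
    intro i
    simp only [sum_form_mul_form ρ B, ← Finset.mul_sum]
    have : ∑ j, B (b j) (b i) * B (b' j) (b' i) = B (b' i) (b i) := by
      conv_rhs => rw [← b.sum_repr (b' i)]
      simp [map_sum, LinearMap.sum_apply, hrepr, mul_comm]
    rw [this, ← hrepr]
    simp
  calc (Module.finrank ℂ V : ℂ) * ∑ g : G, ρ.character (g * g)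
      = ∑ i, ∑ j, (Module.finrank ℂ V : ℂ) *
          ∑ g : G, B (b j) (ρ g⁻¹ (b' i)) * B (b' j) (ρ g (b i)) := by
        simp only [htr, ← Finset.mul_sum]
        rw [Finset.sum_comm]
        congr 1
        exact Finset.sum_congr rfl fun i _ => Finset.sum_comm
    _ = _ := by simp [key]

theorem sum_character_mul_character_inv {V W : Type*} [AddCommGroup V] [Module ℂ V]
    [FiniteDimensional ℂ V] [AddCommGroup W] [Module ℂ W] [FiniteDimensional ℂ W]
    (ρ : Representation ℂ G V) [ρ.IsIrreducible] (σ : Representation ℂ G W) [σ.IsIrreducible]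
    [Decidable (Nonempty (σ.Equiv ρ))] :
    ∑ g : G, ρ.character g * σ.character g⁻¹ =
      if Nonempty (σ.Equiv ρ) then (Fintype.card G : ℂ) else 0 := by
  have : Invertible (Nat.card G : ℂ) := invertibleOfNonzero (by simp)
  have h0 : (Nat.card G : ℂ) ≠ 0 := by simp
  have ho := char_orthonormal ρ σ
  rw [inv_mul_eq_iff_eq_mul₀ h0] at ho
  rw [ho, Nat.card_eq_fintype_card]
  split_ifs <;> simp

section Complete

variable {ι : Type*} {V : ι → Type*} [∀ i, AddCommGroup (V i)] [∀ i, Module ℂ (V i)]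
  [∀ i, FiniteDimensional ℂ (V i)] (ρ : ∀ i, Representation ℂ G (V i))

variable [∀ i, (ρ i).IsIrreducible]

theorem linearIndependent_classCharacter
    (hρ : ∀ i j, Nonempty ((ρ i).Equiv (ρ j)) → i = j) :
    LinearIndependent ℂ fun i => classCharacter (ρ i) := by
  classical
  rw [linearIndependent_iff']
  intro s c hc i hi
  have h1 : ∀ g : G, ∑ j ∈ s, c j * (ρ j).character g = 0 := by
    intro g
    have := congrFun hc (ConjClasses.mk g)
    simpa [Finset.sum_apply, classCharacter_mk] using this
  have h2 : ∑ g : G, (∑ j ∈ s, c j * (ρ j).character g) * (ρ i).character g⁻¹ =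
      c i * Fintype.card G := by
    simp only [Finset.sum_mul]
    rw [Finset.sum_comm]
    simp only [mul_assoc, ← Finset.mul_sum, sum_character_mul_character_inv]
    rw [Finset.sum_eq_single_of_mem i hi]
    · rw [if_pos ⟨Representation.Equiv.refl _⟩]
    · intro j _ hj
      rw [if_neg, mul_zero]
      exact fun h => hj (hρ _ _ h).symm
  simp only [h1, zero_mul, Finset.sum_const_zero] at h2
  simpa using h2.symm

variable [Fintype ι] (hρ : ∀ i j, Nonempty ((ρ i).Equiv (ρ j)) → i = j)
  (hcard : Nat.card (ConjClasses G) ≤ Fintype.card ι)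

include hρ hcard in
/-- If there are at least as many pairwise nonisomorphic irreducible representations `ρ i` as
conjugacy classes, then every class function is a combination of their characters. -/
theorem classFunction_eq_sum_character (θ : G → ℂ) (hθ : ∀ g h, θ (h * g * h⁻¹) = θ g) :
    ∃ c : ι → ℂ, (∀ g, θ g = ∑ i, c i * (ρ i).character g) ∧
      ∀ i, ∑ g, θ g * (ρ i).character g⁻¹ = c i * Fintype.card G := by
  classical
  have : Finite (ConjClasses G) := Quotient.finite _
  have := Fintype.ofFinite (ConjClasses G)
  have hli := linearIndependent_classCharacter ρ hρ
  have hle := hli.fintype_card_le_finrank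
  have hspan := hli.span_eq_top_of_card_eq_finrank' (by
    rw [Module.finrank_fintype_fun_eq_card] at hle ⊢
    rw [Nat.card_eq_fintype_card] at hcard
    exact le_antisymm hle hcard)
  let θ' : ConjClasses G → ℂ := Quotient.lift θ fun a b (h : IsConj a b) => by
    obtain ⟨c, rfl⟩ := isConj_iff.1 h
    rw [hθ]
  have hmem : θ' ∈ Submodule.span ℂ (Set.range fun i => classCharacter (ρ i)) := by
    rw [hspan]; trivial
  obtain ⟨c, hc⟩ := (Submodule.mem_span_range_iff_exists_fun ℂ).1 hmem
  have h1 : ∀ g, θ g = ∑ i, c i * (ρ i).character g := by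
    intro g
    have := congrFun hc (ConjClasses.mk g)
    simp only [Finset.sum_apply, Pi.smul_apply, classCharacter_mk, smul_eq_mul] at this
    exact this.symm
  refine ⟨c, h1, fun i => ?_⟩
  simp only [h1, Finset.sum_mul]
  rw [Finset.sum_comm]
  simp only [mul_assoc, ← Finset.mul_sum, sum_character_mul_character_inv]
  rw [Finset.sum_eq_single i]
  · rw [if_pos ⟨Representation.Equiv.refl _⟩]
  · intro j _ hj
    rw [if_neg, mul_zero]
    exact fun h => hj (hρ _ _ h).symm
  · simp

include hρ hcard in
/-- Pairwise nonisomorphic irreducible representations, at least as many as there are conjugacy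
classes, exhaust the irreducible representations. -/
theorem exists_equiv_of_isIrreducible {W : Type*} [AddCommGroup W] [Module ℂ W]
    [FiniteDimensional ℂ W] (σ : Representation ℂ G W) [σ.IsIrreducible] :
    ∃ i, Nonempty (σ.Equiv (ρ i)) := by
  classical
  by_contra! h
  obtain ⟨c, hc, hc'⟩ := classFunction_eq_sum_character ρ hρ hcard σ.character
    (fun g h => char_conj σ g h)
  have h0 : ∀ i, c i = 0 := by
    intro i
    have := hc' i
    rw [sum_character_mul_character_inv, if_neg] at this
    · simpa using this.symm
    · rintro ⟨e⟩
      exact (h i).false e.symm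
  have h1 := hc 1
  simp only [h0, zero_mul, Finset.sum_const_zero, char_one, Nat.cast_eq_zero] at h1
  exact (finrank_pos_of_isIrreducible σ).ne' h1

include hρ hcard in
/-- If every `ρ i` has an invariant nondegenerate symmetric form, then the dimensions of the `ρ i`
add up to the number of solutions of `g ^ 2 = 1`: both are the value at `1` of the class function
counting square roots. -/
theorem sum_finrank_eq_card_involutions
    (hform : ∀ i, ∃ B : LinearMap.BilinForm ℂ (V i), B.Nondegenerate ∧ (∀ x y, B x y = B y x) ∧
      ∀ g x y, B (ρ i g x) (ρ i g y) = B x y) :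
    ∑ i, Module.finrank ℂ (V i) = Nat.card {g : G // g * g = 1} := by
  classical
  -- the coefficients of `θ` in the irreducible characters are the Frobenius–Schur indicators
  let θ : G → ℂ := fun h => (Finset.univ.filter fun g : G => g * g = h).card
  have hθ : ∀ g h, θ (h * g * h⁻¹) = θ g := by
    intro g h
    simp only [θ, Nat.cast_inj]
    refine Finset.card_equiv (MulAut.conj h⁻¹).toEquiv fun x => ?_
    simp only [Finset.mem_filter, Finset.mem_univ, true_and, MulEquiv.toEquiv_eq_coe,
      MulEquiv.coe_toEquiv, MulAut.conj_apply, inv_inv]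
    constructor
    · intro hx
      calc h⁻¹ * x * h * (h⁻¹ * x * h) = h⁻¹ * (x * x) * h := by group
        _ = g := by rw [hx]; group
    · intro hx
      calc x * x = h * (h⁻¹ * x * h * (h⁻¹ * x * h)) * h⁻¹ := by group
        _ = _ := by rw [hx]
  obtain ⟨c, hc, hc'⟩ := classFunction_eq_sum_character ρ hρ hcard θ hθ
  have h1 : ∀ i, c i = 1 := by
    intro i
    obtain ⟨B, hB, hs, hinv⟩ := hform i
    have h2 := sum_character_mul_self (ρ i) B hB hs hinv
    have h3 : ∑ g, θ g * (ρ i).character g⁻¹ = ∑ g, (ρ i).character (g * g) := by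
      calc ∑ g, θ g * (ρ i).character g⁻¹
          = ∑ g, ∑ x with x * x = g, (ρ i).character (x * x)⁻¹ := by
            refine Finset.sum_congr rfl fun g _ => ?_
            rw [Finset.sum_congr rfl (g := fun _ => (ρ i).character g⁻¹)]
            · simp [θ]
            · intro x hx
              rw [(Finset.mem_filter.1 hx).2]
        _ = ∑ x, (ρ i).character (x * x)⁻¹ := Finset.sum_fiberwise _ _ _
        _ = _ := Fintype.sum_equiv (Equiv.inv G) _ _ fun x => by simp
    rw [hc' i, h2] at h3
    have h4 : (Fintype.card G : ℂ) ≠ 0 := by simp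
    exact mul_right_cancel₀ h4 (h3.trans (one_mul _).symm)
  have h5 := hc 1
  simp only [h1, one_mul, char_one, θ] at h5
  rw [Nat.card_eq_fintype_card, Fintype.card_subtype]
  exact_mod_cast h5.symm

end Complete

end Characters

/-! ### Tableaux and dominance -/

section Combinatorics

variable {r : ℕ}

theorem exists_tableau (μ : PartitionOf r) : Nonempty (Tableau μ) := by
  have h : Fintype.card (Fin r) = Fintype.card μ.1.cells := by
    simpa using μ.2.symm
  exact ⟨Fintype.equivOfCardEq h⟩

theorem mem_columnStabilizer {μ : PartitionOf r} {T : Tableau μ} {q : Equiv.Perm (Fin r)} :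
    q ∈ columnStabilizer T ↔ ∀ i, (T (q i)).1.2 = (T i).1.2 := by
  simp [columnStabilizer]

theorem one_mem_columnStabilizer {μ : PartitionOf r} (T : Tableau μ) :
    1 ∈ columnStabilizer T := by
  simp [mem_columnStabilizer]

theorem mul_mem_columnStabilizer {μ : PartitionOf r} {T : Tableau μ} {p q : Equiv.Perm (Fin r)}
    (hp : p ∈ columnStabilizer T) (hq : q ∈ columnStabilizer T) :
    p * q ∈ columnStabilizer T := by
  rw [mem_columnStabilizer] at *
  intro i
  rw [Equiv.Perm.mul_apply, hp, hq]

theorem inv_mem_columnStabilizer {μ : PartitionOf r} {T : Tableau μ} {q : Equiv.Perm (Fin r)}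
    (hq : q ∈ columnStabilizer T) : q⁻¹ ∈ columnStabilizer T := by
  rw [mem_columnStabilizer] at *
  intro i
  have := hq (q⁻¹ i)
  rw [← this]
  simp

theorem perm_apply {μ : PartitionOf r} (σ : Equiv.Perm (Fin r)) (T : Tableau μ) (i : Fin r) :
    T.perm σ i = T (σ⁻¹ i) := rfl

theorem perm_perm {μ : PartitionOf r} (σ τ : Equiv.Perm (Fin r)) (T : Tableau μ) :
    (T.perm τ).perm σ = T.perm (σ * τ) := rfl

theorem exists_perm_eq {μ : PartitionOf r} (T T' : Tableau μ) : ∃ σ, T.perm σ = T' := by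
  refine ⟨(T'.trans T.symm)⁻¹, ?_⟩
  ext1 i
  simp [perm_apply]

theorem columnStabilizer_perm {μ : PartitionOf r} {T : Tableau μ} {q : Equiv.Perm (Fin r)}
    (hq : q ∈ columnStabilizer T) : columnStabilizer (T.perm q) = columnStabilizer T := by
  have h : ∀ i, (T.perm q i).1.2 = (T i).1.2 := fun i => by
    rw [perm_apply]
    exact mem_columnStabilizer.1 (inv_mem_columnStabilizer hq) i
  ext p
  simp only [mem_columnStabilizer, h]

/-- If the letters in each column of `T` lie in different rows according to `f`, the columns of `T`
can be sorted by `f`; the row of a letter is then at most its value under `f`. -/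
theorem exists_tabloid_le {μ : PartitionOf r} (T : Tableau μ) (f : Fin r → ℕ)
    (hf : ∀ i j, (T i).1.2 = (T j).1.2 → f i = f j → i = j) :
    ∃ q ∈ columnStabilizer T, ∀ i, tabloid (T.perm q) i ≤ f i := by
  -- the new row of a letter is the number of letters of its column with a smaller value
  let C : Fin r → Finset (Fin r) := fun i =>
    Finset.univ.filter fun j => (T j).1.2 = (T i).1.2 ∧ f j < f i
  have hC : ∀ i, (C i).card ≤ f i := by
    intro i
    rw [← Finset.card_range (f i)]
    refine Finset.card_le_card_of_injOn f ?_ ?_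
    · intro j hj
      simp only [C, Finset.coe_filter, Finset.mem_univ, true_and, Set.mem_ofPred_eq] at hj
      simpa using hj.2
    · intro j hj k hk h
      simp only [C, Finset.coe_filter, Finset.mem_univ, true_and, Set.mem_ofPred_eq] at hj hk
      exact hf j k (hj.1.trans hk.1.symm) h
  have hlen : ∀ i, (C i).card < μ.1.colLen (T i).1.2 := by
    intro i
    rw [YoungDiagram.colLen_eq_card]
    have : (C i).card < (Finset.univ.filter fun j => (T j).1.2 = (T i).1.2).card := by
      apply Finset.card_lt_card
      rw [Finset.ssubset_iff_of_subset]
      · exact ⟨i, by simp, by simp [C]⟩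
      · intro j hj
        simp only [C, Finset.mem_filter, Finset.mem_univ, true_and] at hj ⊢
        exact hj.1
    refine this.trans_le ?_
    refine Finset.card_le_card_of_injOn (fun j => (T j).1) ?_ ?_
    · intro j hj
      simp only [Finset.coe_filter, Finset.mem_univ, true_and, Set.mem_ofPred_eq] at hj
      simp only [Finset.mem_coe, YoungDiagram.mem_col_iff]
      exact ⟨(T j).2, hj⟩
    · intro j _ k _ h
      exact T.injective (Subtype.ext h)
  have hmono : ∀ i j, (T i).1.2 = (T j).1.2 → f i < f j → (C i).card < (C j).card := by
    intro i j hij hlt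
    apply Finset.card_lt_card
    rw [Finset.ssubset_iff_of_subset]
    · exact ⟨i, by simp [C, hij, hlt], by simp [C]⟩
    · intro k hk
      simp only [C, Finset.mem_filter, Finset.mem_univ, true_and] at hk ⊢
      exact ⟨hk.1.trans hij, hk.2.trans hlt⟩
  let g : Fin r → μ.1.cells := fun i =>
    ⟨((C i).card, (T i).1.2), by
      rw [YoungDiagram.mem_cells, YoungDiagram.mem_iff_lt_colLen]
      exact hlen i⟩
  have hg : Function.Injective g := by
    intro i j hij
    simp only [g, Subtype.mk.injEq, Prod.mk.injEq] at hij
    rcases lt_trichotomy (f i) (f j) with h | h | h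
    · have := hmono i j hij.2 h
      omega
    · exact hf i j hij.2 h
    · have := hmono j i hij.2.symm h
      omega
  have hbij : Function.Bijective g := by
    rw [Fintype.bijective_iff_injective_and_card]
    exact ⟨hg, by simpa using μ.2.symm⟩
  obtain ⟨q, hq⟩ := exists_perm_eq T (Equiv.ofBijective g hbij)
  have hqi : ∀ i, (T (q⁻¹ i)).1 = ((C i).card, (T i).1.2) := fun i => by
    rw [← perm_apply, hq]
    rfl
  refine ⟨q, ?_, fun i => ?_⟩
  · rw [← inv_inv q]
    apply inv_mem_columnStabilizer
    rw [mem_columnStabilizer]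
    intro i
    rw [hqi]
  · rw [tabloid, perm_apply, hqi]
    exact hC i

theorem card_tabloid_lt {μ : PartitionOf r} (T : Tableau μ) (k : ℕ) :
    (Finset.univ.filter fun i => tabloid T i < k).card =
      (μ.1.cells.filter fun c => c.1 < k).card := by
  refine Finset.card_bij (fun i _ => (T i).1) ?_ ?_ ?_
  · intro i hi
    simp only [Finset.mem_filter, Finset.mem_univ, true_and] at hi ⊢
    exact ⟨(T i).2, hi⟩
  · intro i _ j _ h
    exact T.injective (Subtype.ext h)
  · intro c hc
    rw [Finset.mem_filter] at hc
    refine ⟨T.symm ⟨c, hc.1⟩, ?_, by simp⟩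
    rw [Finset.mem_filter, tabloid, Equiv.apply_symm_apply]
    exact ⟨Finset.mem_univ _, hc.2⟩

theorem sum_tabloid {μ : PartitionOf r} (T : Tableau μ) :
    ∑ i, tabloid T i = ∑ c : μ.1.cells, c.1.1 :=
  Fintype.sum_equiv T _ _ fun _ => rfl

/-- For equal shapes the inequality of `exists_tabloid_le` is an equality, since the row indices of all
letters have the same sum on both sides. -/
theorem exists_perm_tabloid_eq {μ : PartitionOf r} (T T' : Tableau μ)
    (h : ∀ i j, (T i).1.2 = (T j).1.2 → tabloid T' i = tabloid T' j → i = j) :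
    ∃ q ∈ columnStabilizer T, tabloid (T.perm q) = tabloid T' := by
  obtain ⟨q, hq, hle⟩ := exists_tabloid_le T _ h
  refine ⟨q, hq, funext fun i => ?_⟩
  have hs : ∑ i, tabloid (T.perm q) i = ∑ i, tabloid T' i := by
    rw [sum_tabloid, sum_tabloid]
  exact (Finset.sum_eq_sum_iff_of_le fun i _ => hle i).1 hs i (Finset.mem_univ i)

/-- The dominance inequality between two shapes, in terms of the numbers of cells in the first
rows. -/
theorem card_filter_le_of_injective {μ ν : PartitionOf r} (T : Tableau μ) (T' : Tableau ν)
    (h : ∀ i j, (T i).1.2 = (T j).1.2 → tabloid T' i = tabloid T' j → i = j) (k : ℕ) :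
    (ν.1.cells.filter fun c => c.1 < k).card ≤ (μ.1.cells.filter fun c => c.1 < k).card := by
  obtain ⟨q, -, hle⟩ := exists_tabloid_le T _ h
  rw [← card_tabloid_lt T' k, ← card_tabloid_lt (T.perm q) k]
  apply Finset.card_le_card
  intro i hi
  simp only [Finset.mem_filter, Finset.mem_univ, true_and] at hi ⊢
  exact (hle i).trans_lt hi

theorem youngDiagram_ext_of_card_filter {μ ν : YoungDiagram}
    (h : ∀ k, (ν.cells.filter fun c => c.1 < k).card = (μ.cells.filter fun c => c.1 < k).card) :
    μ = ν := by
  have key : ∀ (μ : YoungDiagram) (k : ℕ), (μ.cells.filter fun c => c.1 < k + 1).card =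
      (μ.cells.filter fun c => c.1 < k).card + μ.rowLen k := by
    intro μ k
    rw [YoungDiagram.rowLen_eq_card, ← Finset.card_union_of_disjoint]
    · congr 1
      ext c
      simp only [Finset.mem_filter, Finset.mem_union, YoungDiagram.mem_row_iff,
        YoungDiagram.mem_cells]
      rw [Nat.lt_succ_iff_lt_or_eq]
      tauto
    · rw [Finset.disjoint_left]
      intro c hc hc'
      simp only [Finset.mem_filter, YoungDiagram.mem_row_iff] at hc hc'
      omega
  have hrow : ∀ k, μ.rowLen k = ν.rowLen k := by
    intro k
    have h1 := key μ k
    have h2 := key ν k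
    rw [h, h] at h2
    omega
  ext ⟨i, j⟩
  rw [YoungDiagram.mem_cells, YoungDiagram.mem_cells, YoungDiagram.mem_iff_lt_rowLen,
    YoungDiagram.mem_iff_lt_rowLen, hrow]

end Combinatorics

/-! ### Partitions and conjugacy classes -/

section ConjugacyClasses

theorem card_cellsOfRowLens (w : List ℕ) : (YoungDiagram.cellsOfRowLens w).card = w.sum := by
  induction w with
  | nil => rfl
  | cons a w ih =>
    rw [YoungDiagram.cellsOfRowLens, Finset.card_union_of_disjoint, Finset.card_map, ih]
    · simp
    · rw [Finset.disjoint_left]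
      rintro ⟨i, j⟩ h h'
      simp at h h'
      omega

/-- The Young diagram whose row lengths are the cycle lengths of a permutation. -/
noncomputable def cycleDiagram {r : ℕ} (σ : Equiv.Perm (Fin r)) : PartitionOf r :=
  ⟨YoungDiagram.ofRowLens (σ.partition.parts.sort (· ≥ ·)) (Multiset.pairwise_sort _ _).sortedGE, by
    rw [YoungDiagram.card, YoungDiagram.ofRowLens, card_cellsOfRowLens, ← Multiset.sum_coe,
      Multiset.sort_eq, σ.partition.parts_sum, Fintype.card_fin]⟩

theorem isConj_of_cycleDiagram_eq {r : ℕ} {σ τ : Equiv.Perm (Fin r)}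
    (h : cycleDiagram σ = cycleDiagram τ) : IsConj σ τ := by
  rw [Equiv.Perm.partition_eq_of_isConj]
  have h1 := congrArg YoungDiagram.rowLens (congrArg Subtype.val h)
  have pos : ∀ σ : Equiv.Perm (Fin r), ∀ x ∈ σ.partition.parts.sort (· ≥ ·), 0 < x := by
    intro σ x hx
    exact σ.partition.parts_pos ((Multiset.mem_sort _).1 hx)
  simp only [cycleDiagram] at h1
  rw [YoungDiagram.rowLens_ofRowLens_eq_self (pos σ),
    YoungDiagram.rowLens_ofRowLens_eq_self (pos τ)] at h1
  apply Nat.Partition.ext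
  rw [← Multiset.sort_eq σ.partition.parts (· ≥ ·), h1, Multiset.sort_eq]

instance finite_partitionOf (r : ℕ) : Finite (PartitionOf r) := by
  have h : ∀ μ : PartitionOf r, μ.1.cells ⊆ Finset.range r ×ˢ Finset.range r := by
    rintro μ ⟨i, j⟩ hc
    have h1 : (Finset.range (i + 1)).card ≤ μ.1.cells.card :=
      Finset.card_le_card_of_injOn (fun k => (k, j)) (fun k hk => by
        have : k ≤ i := by simpa [Nat.lt_succ_iff] using hk
        exact μ.1.up_left_mem this le_rfl hc) (fun a _ b _ h => by simpa using h)
    have h2 : (Finset.range (j + 1)).card ≤ μ.1.cells.card :=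
      Finset.card_le_card_of_injOn (fun k => (i, k)) (fun k hk => by
        have : k ≤ j := by simpa [Nat.lt_succ_iff] using hk
        exact μ.1.up_left_mem le_rfl this hc) (fun a _ b _ h => by simpa using h)
    have h3 : μ.1.cells.card = r := μ.2
    simp at h1 h2 ⊢
    omega
  refine Finite.of_injective (β := (Finset.range r ×ˢ Finset.range r).powerset)
    (fun μ => ⟨μ.1.cells, Finset.mem_powerset.2 (h μ)⟩) fun μ ν hμν => ?_
  apply Subtype.ext
  apply YoungDiagram.ext
  simpa using hμν

theorem card_conjClasses_le (r : ℕ) :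
    Nat.card (ConjClasses (Equiv.Perm (Fin r))) ≤ Nat.card (PartitionOf r) := by
  refine Nat.card_le_card_of_injective (fun c => cycleDiagram (Quotient.out c)) fun c d h => ?_
  have h1 := isConj_of_cycleDiagram_eq h
  rw [← Quotient.out_eq c, ← Quotient.out_eq d]
  exact Quotient.sound h1

end ConjugacyClasses

/-! ### Irreducibility of the Specht modules -/

section SpechtModules

variable {r : ℕ}

theorem rowRep_single (σ : Equiv.Perm (Fin r)) (f : Fin r → ℕ) (a : ℂ) :
    rowRep r σ (Finsupp.single f a) = Finsupp.single (f ∘ (σ⁻¹ : Equiv.Perm (Fin r))) a := by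
  simp [rowRep]

theorem rowRep_single_tabloid {μ : PartitionOf r} (σ : Equiv.Perm (Fin r)) (T : Tableau μ)
    (a : ℂ) : rowRep r σ (Finsupp.single (tabloid T) a) =
      Finsupp.single (tabloid (T.perm σ)) a :=
  rowRep_single σ _ a

theorem rowRep_apply (σ : Equiv.Perm (Fin r)) (u : (Fin r → ℕ) →₀ ℂ) (f : Fin r → ℕ) :
    rowRep r σ u f = u (f ∘ σ) := by
  induction u using Finsupp.induction_linear with
  | zero => simp
  | add u v hu hv => simp [hu, hv]
  | single g a =>
    rw [rowRep_single, Finsupp.single_apply, Finsupp.single_apply]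
    congr 1
    apply propext
    constructor
    · rintro rfl
      ext; simp
    · rintro rfl
      ext; simp

/-- The symmetric bilinear form for which the assignments of letters to rows are orthonormal. -/
noncomputable def rowForm (r : ℕ) : LinearMap.BilinForm ℂ ((Fin r → ℕ) →₀ ℂ) :=
  Finsupp.linearCombination ℂ fun f => (Finsupp.lapply f : ((Fin r → ℕ) →₀ ℂ) →ₗ[ℂ] ℂ)

theorem rowForm_single_left (f : Fin r → ℕ) (a : ℂ) (v : (Fin r → ℕ) →₀ ℂ) :
    rowForm r (Finsupp.single f a) v = a * v f := by
  simp [rowForm]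

theorem rowForm_comm (u v : (Fin r → ℕ) →₀ ℂ) : rowForm r u v = rowForm r v u := by
  induction u using Finsupp.induction_linear with
  | zero => simp
  | add u u' hu hu' => simp [hu, hu']
  | single f a =>
    induction v using Finsupp.induction_linear with
    | zero => simp
    | add u u' hu hu' => rw [map_add, hu, hu', map_add, LinearMap.add_apply]
    | single g b =>
      rw [rowForm_single_left, rowForm_single_left, Finsupp.single_apply, Finsupp.single_apply]
      by_cases h : g = f
      · simp [h, mul_comm]
      · simp [h, Ne.symm h]

theorem rowForm_rowRep (σ : Equiv.Perm (Fin r)) (u v : (Fin r → ℕ) →₀ ℂ) :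
    rowForm r (rowRep r σ u) (rowRep r σ v) = rowForm r u v := by
  induction u using Finsupp.induction_linear with
  | zero => simp
  | add u u' hu hu' => simp [hu, hu']
  | single f a =>
    rw [rowRep_single, rowForm_single_left, rowForm_single_left, rowRep_apply]
    congr 2
    ext; simp

/-- The column antisymmetrizer `∑_{q ∈ C_T} sgn(q) q`, acting on assignments of letters to rows. -/
noncomputable def columnAntisymmetrizer {μ : PartitionOf r} (T : Tableau μ) :
    ((Fin r → ℕ) →₀ ℂ) →ₗ[ℂ] ((Fin r → ℕ) →₀ ℂ) :=
  ∑ q ∈ columnStabilizer T, ((Equiv.Perm.sign q : ℤ) : ℂ) • rowRep r q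

theorem columnAntisymmetrizer_apply {μ : PartitionOf r} (T : Tableau μ) (u : (Fin r → ℕ) →₀ ℂ) :
    columnAntisymmetrizer T u =
      ∑ q ∈ columnStabilizer T, ((Equiv.Perm.sign q : ℤ) : ℂ) • rowRep r q u := by
  simp [columnAntisymmetrizer, LinearMap.sum_apply]

theorem columnAntisymmetrizer_tabloid {μ : PartitionOf r} (T : Tableau μ) :
    columnAntisymmetrizer T (Finsupp.single (tabloid T) 1) = polytabloid T := by
  rw [columnAntisymmetrizer_apply, polytabloid]
  exact Finset.sum_congr rfl fun q _ => by simp [rowRep_single_tabloid]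

theorem columnAntisymmetrizer_rowRep {μ : PartitionOf r} (T : Tableau μ) {q : Equiv.Perm (Fin r)}
    (hq : q ∈ columnStabilizer T) (u : (Fin r → ℕ) →₀ ℂ) :
    columnAntisymmetrizer T (rowRep r q u) =
      ((Equiv.Perm.sign q : ℤ) : ℂ) • columnAntisymmetrizer T u := by
  rw [columnAntisymmetrizer_apply, columnAntisymmetrizer_apply, Finset.smul_sum]
  refine Finset.sum_bij' (fun p _ => p * q) (fun p _ => p * q⁻¹)
    (fun p hp => mul_mem_columnStabilizer hp hq)
    (fun p hp => mul_mem_columnStabilizer hp (inv_mem_columnStabilizer hq))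
    (fun p _ => by group) (fun p _ => by group) fun p _ => ?_
  rw [map_mul, map_mul, Module.End.mul_apply, smul_smul]
  congr 1
  rcases Int.units_eq_one_or (Equiv.Perm.sign q) with h | h <;> simp [h]

/-- An assignment that puts two letters of a column of `T` into the same row is fixed by their
transposition, hence killed by the antisymmetrizer. -/
theorem columnAntisymmetrizer_single_eq_zero {μ : PartitionOf r} (T : Tableau μ)
    (f : Fin r → ℕ) (a : ℂ) {i j : Fin r} (hij : i ≠ j) (hcol : (T i).1.2 = (T j).1.2)
    (hf : f i = f j) : columnAntisymmetrizer T (Finsupp.single f a) = 0 := by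
  have hq : Equiv.swap i j ∈ columnStabilizer T := by
    rw [mem_columnStabilizer]
    intro k
    by_cases hi : k = i
    · subst hi; simp [hcol]
    by_cases hj : k = j
    · subst hj; simp [hcol]
    rw [Equiv.swap_apply_of_ne_of_ne hi hj]
  have h1 := columnAntisymmetrizer_rowRep T hq (Finsupp.single f a)
  have h2 : f ∘ ((Equiv.swap i j)⁻¹ : Equiv.Perm (Fin r)) = f := by
    ext k
    by_cases hi : k = i
    · subst hi; simp [hf]
    by_cases hj : k = j
    · subst hj; simp [hf]
    simp [Equiv.swap_apply_of_ne_of_ne hi hj]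
  rw [rowRep_single, h2, Equiv.Perm.sign_swap hij] at h1
  exact self_eq_neg.1 (by simpa using h1)

theorem rowForm_columnAntisymmetrizer {μ : PartitionOf r} (T : Tableau μ)
    (u v : (Fin r → ℕ) →₀ ℂ) :
    rowForm r (columnAntisymmetrizer T u) v = rowForm r u (columnAntisymmetrizer T v) := by
  rw [columnAntisymmetrizer_apply, columnAntisymmetrizer_apply]
  simp only [map_sum, LinearMap.sum_apply, map_smul, LinearMap.smul_apply]
  refine Finset.sum_bij' (fun q _ => q⁻¹) (fun q _ => q⁻¹)
    (fun q hq => inv_mem_columnStabilizer hq) (fun q hq => inv_mem_columnStabilizer hq)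
    (fun q _ => inv_inv q) (fun q _ => inv_inv q) fun q _ => ?_
  rw [Equiv.Perm.sign_inv, ← rowForm_rowRep q⁻¹ (rowRep r q u), ← Module.End.mul_apply, ← map_mul]
  simp

theorem columnAntisymmetrizer_polytabloid {μ : PartitionOf r} (T : Tableau μ) :
    columnAntisymmetrizer T (polytabloid T) =
      ((columnStabilizer T).card : ℂ) • polytabloid T := by
  have h : polytabloid T = ∑ q ∈ columnStabilizer T, ((Equiv.Perm.sign q : ℤ) : ℂ) •
      rowRep r q (Finsupp.single (tabloid T) 1) := by
    rw [← columnAntisymmetrizer_tabloid, columnAntisymmetrizer_apply]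
  conv_lhs => rw [h]
  rw [map_sum, Finset.sum_congr rfl (g := fun _ => polytabloid T)]
  · rw [Finset.sum_const, Nat.cast_smul_eq_nsmul]
  · intro q hq
    rw [map_smul, columnAntisymmetrizer_rowRep T hq, columnAntisymmetrizer_tabloid, smul_smul]
    rcases Int.units_eq_one_or (Equiv.Perm.sign q) with h | h <;> simp [h]

theorem columnAntisymmetrizer_single_tabloid {μ : PartitionOf r} (T T' : Tableau μ) (a : ℂ) :
    ∃ c : ℂ, columnAntisymmetrizer T (Finsupp.single (tabloid T') a) = c • polytabloid T := by
  by_cases h : ∀ i j, (T i).1.2 = (T j).1.2 → tabloid T' i = tabloid T' j → i = j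
  · obtain ⟨q, hq, hT⟩ := exists_perm_tabloid_eq T T' h
    refine ⟨a * ((Equiv.Perm.sign q : ℤ) : ℂ), ?_⟩
    rw [← hT, ← rowRep_single_tabloid, columnAntisymmetrizer_rowRep T hq, mul_comm, mul_smul,
      ← columnAntisymmetrizer_tabloid, ← map_smul _ a]
    simp
  · push Not at h
    obtain ⟨i, j, hcol, hf, hij⟩ := h
    exact ⟨0, by rw [columnAntisymmetrizer_single_eq_zero T _ a hij hcol hf, zero_smul]⟩

theorem polytabloid_mem_specht {μ : PartitionOf r} (T : Tableau μ) :
    polytabloid T ∈ (specht μ).toSubmodule :=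
  Submodule.subset_span ⟨T, rfl⟩

theorem specht_induction {μ : PartitionOf r} {p : ((Fin r → ℕ) →₀ ℂ) → Prop}
    (h0 : p 0) (hadd : ∀ u v, p u → p v → p (u + v)) (hsmul : ∀ (c : ℂ) u, p u → p (c • u))
    (hp : ∀ T : Tableau μ, p (polytabloid T)) : ∀ u ∈ (specht μ).toSubmodule, p u := by
  intro u hu
  refine Submodule.span_induction ?_ h0 (fun u v _ _ => hadd u v) (fun c u _ => hsmul c u) hu
  rintro _ ⟨T, rfl⟩
  exact hp T

theorem specht_le_span_tabloid (μ : PartitionOf r) :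
    (specht μ).toSubmodule ≤
      Submodule.span ℂ (Set.range fun T : Tableau μ => Finsupp.single (tabloid T) (1 : ℂ)) := by
  refine Submodule.span_le.2 ?_
  rintro _ ⟨T, rfl⟩
  refine Submodule.sum_mem _ fun q _ => ?_
  rw [← mul_one ((Equiv.Perm.sign q : ℤ) : ℂ), ← smul_eq_mul, ← Finsupp.smul_single]
  exact Submodule.smul_mem _ _ (Submodule.subset_span ⟨_, rfl⟩)

instance finiteDimensional_specht (μ : PartitionOf r) :
    FiniteDimensional ℂ (specht μ).toSubmodule := by
  have : Finite (Tableau μ) := inferInstance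
  exact FiniteDimensional.span_of_finite ℂ (Set.finite_range _)

/-- James's argument: on the Specht module, `T` antisymmetrizes everything to a multiple of the
polytabloid of `T`. -/
theorem exists_columnAntisymmetrizer_eq_smul {μ : PartitionOf r} (T : Tableau μ)
    {u : (Fin r → ℕ) →₀ ℂ} (hu : u ∈ (specht μ).toSubmodule) :
    ∃ c : ℂ, columnAntisymmetrizer T u = c • polytabloid T := by
  refine Submodule.span_induction ?_ ⟨0, by simp⟩ ?_ ?_ (specht_le_span_tabloid μ hu)
  · rintro _ ⟨T', rfl⟩
    exact columnAntisymmetrizer_single_tabloid T T' 1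
  · rintro u v _ _ ⟨c, hc⟩ ⟨d, hd⟩
    exact ⟨c + d, by rw [map_add, hc, hd, add_smul]⟩
  · rintro a u _ ⟨c, hc⟩
    exact ⟨a * c, by rw [map_smul, hc, smul_smul]⟩

theorem polytabloid_ne_zero {μ : PartitionOf r} (T : Tableau μ) : polytabloid T ≠ 0 := by
  have h : polytabloid T (tabloid T) = 1 := by
    rw [polytabloid, Finsupp.finsetSum_apply,
      Finset.sum_eq_single_of_mem 1 (one_mem_columnStabilizer T)]
    · have : T.perm 1 = T := rfl
      simp [this]
    · intro q hq hq1
      rw [Finsupp.single_apply, if_neg]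
      intro h
      apply hq1
      rw [← inv_eq_one]
      ext1 i
      apply T.injective
      apply Subtype.ext
      exact Prod.ext (congrFun h i)
        (mem_columnStabilizer.1 (inv_mem_columnStabilizer hq) i)
  intro h0
  simp [h0] at h

/-- The Specht module is spanned by real vectors, so the bilinear form `rowForm` is nondegenerate
on it. -/
theorem eq_zero_of_rowForm_specht {μ : PartitionOf r} {u : (Fin r → ℕ) →₀ ℂ}
    (hu : u ∈ (specht μ).toSubmodule) (h : ∀ v ∈ (specht μ).toSubmodule, rowForm r u v = 0) :
    u = 0 := by
  have hconj : ∀ u ∈ (specht μ).toSubmodule,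
      u.mapRange (starRingEnd ℂ) (map_zero _) ∈ (specht μ).toSubmodule := by
    apply specht_induction
    · simp
    · intro u v hu hv
      rw [Finsupp.mapRange_add (map_add _)]
      exact Submodule.add_mem _ hu hv
    · intro c u hu
      have : (c • u).mapRange (starRingEnd ℂ) (map_zero _) =
          starRingEnd ℂ c • u.mapRange (starRingEnd ℂ) (map_zero _) := by
        ext f
        simp
      rw [this]
      exact Submodule.smul_mem _ _ hu
    · intro T
      have : (polytabloid T).mapRange (starRingEnd ℂ) (map_zero _) = polytabloid T := by
        ext f
        simp only [polytabloid, Finsupp.mapRange_apply, Finsupp.finsetSum_apply, map_sum,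
          Finsupp.single_apply]
        refine Finset.sum_congr rfl fun q _ => ?_
        split_ifs <;> simp
      rw [this]
      exact polytabloid_mem_specht T
  have h1 := h _ (hconj u hu)
  have h2 : rowForm r u (u.mapRange (starRingEnd ℂ) (map_zero _)) =
      ((∑ f ∈ u.support, Complex.normSq (u f) : ℝ) : ℂ) := by
    rw [rowForm, Finsupp.linearCombination_apply, Finsupp.sum, LinearMap.sum_apply]
    push_cast
    exact Finset.sum_congr rfl fun f _ => by simp [Complex.mul_conj]
  rw [h2, Complex.ofReal_eq_zero, Finset.sum_eq_zero_iff_of_nonneg fun f _ =>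
    Complex.normSq_nonneg _] at h1
  ext f
  by_cases hf : f ∈ u.support
  · simpa using h1 f hf
  · simpa using hf

theorem exists_form_specht (μ : PartitionOf r) :
    ∃ B : LinearMap.BilinForm ℂ (specht μ).toSubmodule, B.Nondegenerate ∧
      (∀ x y, B x y = B y x) ∧ ∀ g x y,
        B ((specht μ).toRepresentation g x) ((specht μ).toRepresentation g y) = B x y := by
  have hs : ∀ x y, (rowForm r).restrict (specht μ).toSubmodule x y =
      (rowForm r).restrict (specht μ).toSubmodule y x := fun x y => rowForm_comm _ _
  refine ⟨(rowForm r).restrict (specht μ).toSubmodule, ?_, hs, fun g x y => rowForm_rowRep g _ _⟩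
  constructor
  · intro x hx
    exact Subtype.ext (eq_zero_of_rowForm_specht x.2 fun v hv => hx ⟨v, hv⟩)
  · intro x hx
    exact Subtype.ext (eq_zero_of_rowForm_specht x.2 fun v hv => (hs x ⟨v, hv⟩).trans (hx ⟨v, hv⟩))

instance isIrreducible_specht (μ : PartitionOf r) :
    Representation.IsIrreducible (k := ℂ) (V := (specht μ).toSubmodule)
      (specht μ).toRepresentation where
  exists_pair_ne := by
    refine ⟨⊥, ⊤, fun h => ?_⟩
    obtain ⟨T⟩ := exists_tableau μ
    have h1 : (⟨polytabloid T, polytabloid_mem_specht T⟩ : (specht μ).toSubmodule) ∈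
        (⊥ : Subrepresentation (specht μ).toRepresentation) := by
      rw [h]; trivial
    exact polytabloid_ne_zero T (congrArg Subtype.val ((Submodule.mem_bot ℂ).1 h1))
  eq_bot_or_eq_top U := by
    by_cases hU : ∀ (T : Tableau μ), ∀ u ∈ U, columnAntisymmetrizer T u.1 = 0
    · left
      -- such a `U` is orthogonal to all polytabloids
      apply Subrepresentation.toSubmodule_injective
      refine (Submodule.eq_bot_iff _).2 fun u hu => Subtype.ext ?_
      refine eq_zero_of_rowForm_specht u.2 (specht_induction (map_zero _) ?_ ?_ ?_)
      · intro v w hv hw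
        rw [map_add, hv, hw, add_zero]
      · intro c v hv
        rw [map_smul, hv, smul_zero]
      · intro T
        rw [← columnAntisymmetrizer_tabloid, ← rowForm_columnAntisymmetrizer, hU T u hu]
        simp
    · right
      push Not at hU
      obtain ⟨T, u, hu, hne⟩ := hU
      obtain ⟨c, hc⟩ := exists_columnAntisymmetrizer_eq_smul T u.2
      have hc0 : c ≠ 0 := by
        rintro rfl
        exact hne (by rw [hc, zero_smul])
      have hmem : ∀ q : Equiv.Perm (Fin r), (specht μ).toRepresentation q u ∈ U :=
        fun q => U.apply_mem_toSubmodule q hu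
      have hT : (⟨polytabloid T, polytabloid_mem_specht T⟩ : (specht μ).toSubmodule) ∈
          U.toSubmodule := by
        have h1 : c⁻¹ • ∑ q ∈ columnStabilizer T, ((Equiv.Perm.sign q : ℤ) : ℂ) •
            (specht μ).toRepresentation q u ∈ U.toSubmodule :=
          Submodule.smul_mem _ _ (Submodule.sum_mem _ fun q _ => Submodule.smul_mem _ _ (hmem q))
        convert h1 using 1
        apply Subtype.ext
        have h2 : polytabloid T = c⁻¹ • columnAntisymmetrizer T u.1 := by
          rw [hc, smul_smul, inv_mul_cancel₀ hc0, one_smul]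
        refine h2.trans ?_
        rw [columnAntisymmetrizer_apply]
        simp only [Submodule.coe_smul, AddSubmonoidClass.coe_finsetSum]
        rfl
      apply Subrepresentation.toSubmodule_injective
      refine (Submodule.eq_top_iff').2 fun v => ?_
      have h3 : ∀ v ∈ (specht μ).toSubmodule,
          v ∈ U.toSubmodule.map (specht μ).toSubmodule.subtype := by
        refine specht_induction (Submodule.zero_mem _)
          (fun _ _ => Submodule.add_mem _) (fun c _ => Submodule.smul_mem _ c) fun T' => ?_
        obtain ⟨σ, rfl⟩ := exists_perm_eq T T'
        exact ⟨_, U.apply_mem_toSubmodule σ hT, rowRep_polytabloid σ T⟩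
      obtain ⟨w, hw, hwv⟩ := h3 v v.2
      rwa [← Subtype.ext hwv]

/-- If `S^μ` and `S^ν` are isomorphic, the antisymmetrizer of a tableau of shape `μ` acts nontrivially
on the tabloids of shape `ν`, which yields a dominance inequality. -/
theorem card_filter_le_of_equiv {μ ν : PartitionOf r}
    (e : (specht μ).toRepresentation.Equiv (specht ν).toRepresentation) (k : ℕ) :
    (ν.1.cells.filter fun c => c.1 < k).card ≤ (μ.1.cells.filter fun c => c.1 < k).card := by
  obtain ⟨T⟩ := exists_tableau μ
  obtain ⟨T', hT'⟩ : ∃ T' : Tableau ν,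
      columnAntisymmetrizer T (Finsupp.single (tabloid T') 1) ≠ 0 := by
    by_contra! h
    have h1 : ∀ u ∈ (specht ν).toSubmodule, columnAntisymmetrizer T u = 0 := by
      intro u hu
      refine (LinearMap.mem_ker (f := columnAntisymmetrizer T)).1
        ((Submodule.span_le.2 ?_) (specht_le_span_tabloid ν hu))
      rintro _ ⟨T', rfl⟩
      exact h T'
    have h2 : e (∑ q ∈ columnStabilizer T, ((Equiv.Perm.sign q : ℤ) : ℂ) •
        (specht μ).toRepresentation q ⟨polytabloid T, polytabloid_mem_specht T⟩) = 0 := by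
      apply Subtype.ext
      rw [ZeroMemClass.coe_zero, ← h1 _ (e ⟨polytabloid T, polytabloid_mem_specht T⟩).2,
        columnAntisymmetrizer_apply]
      have h4 : ∀ q x, e ((specht μ).toRepresentation q x) =
        (specht ν).toRepresentation q (e x) := fun q x =>
          Representation.IntertwiningMap.isIntertwining _ _ e.toIntertwiningMap q x
      rw [map_sum, AddSubmonoidClass.coe_finsetSum]
      refine Finset.sum_congr rfl fun q _ => ?_
      rw [map_smul, h4]
      rfl
    have h3 := e.toLinearEquiv.injective (h2.trans (map_zero e).symm)
    have h4 := congrArg Subtype.val h3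
    have h5 : columnAntisymmetrizer T (polytabloid T) = 0 := by
      rw [columnAntisymmetrizer_apply, ← ZeroMemClass.coe_zero (specht μ).toSubmodule, ← h4,
        AddSubmonoidClass.coe_finsetSum]
      rfl
    rw [columnAntisymmetrizer_polytabloid, smul_eq_zero, Nat.cast_eq_zero,
      Finset.card_eq_zero] at h5
    rcases h5 with h5 | h5
    · exact Finset.ne_empty_of_mem (one_mem_columnStabilizer T) h5
    · exact polytabloid_ne_zero T h5
  refine card_filter_le_of_injective T T' (fun i j hcol hf => ?_) k
  by_contra hij
  exact hT' (columnAntisymmetrizer_single_eq_zero T _ 1 hij hcol hf)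

theorem eq_of_equiv_specht {μ ν : PartitionOf r}
    (h : Nonempty ((specht μ).toRepresentation.Equiv (specht ν).toRepresentation)) : μ = ν := by
  obtain ⟨e⟩ := h
  exact Subtype.ext (youngDiagram_ext_of_card_filter fun k =>
    le_antisymm (card_filter_le_of_equiv e k) (card_filter_le_of_equiv e.symm k))

end SpechtModules

/-! ### Fermionic modes indexed by the cells of the plane -/

section FockSpace

/-- The Jordan–Wigner sign of a pair of modes (cells of `ℕ × ℕ`, as `(row, column)`): it is `-1` if
`c` lies strictly below `d` in the same column, and `1` otherwise. Exchanging `c` and `d` changes it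
exactly when the two modes are distinct and lie in the same column. -/
def modeSign (c d : ℕ × ℕ) : ℂ :=
  if c.2 = d.2 ∧ d.1 < c.1 then -1 else 1

/-- The creation operator of the mode `c`. States are functions of the set of occupied modes; the
vacuum is `Pi.single ∅ 1`. -/
def modeOperator (c : ℕ × ℕ) : Module.End ℂ (Finset (ℕ × ℕ) → ℂ) where
  toFun φ S := if c ∈ S then (∏ d ∈ S.erase c, modeSign c d) * φ (S.erase c) else 0
  map_add' φ ψ := by
    ext S
    simp only [Pi.add_apply]
    split_ifs <;> ring
  map_smul' a φ := by
    ext S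
    simp only [Pi.smul_apply, smul_eq_mul, RingHom.id_apply]
    split_ifs <;> ring

theorem modeOperator_apply (c : ℕ × ℕ) (φ : Finset (ℕ × ℕ) → ℂ) (S : Finset (ℕ × ℕ)) :
    modeOperator c φ S =
      if c ∈ S then (∏ d ∈ S.erase c, modeSign c d) * φ (S.erase c) else 0 := rfl

theorem modeOperator_mul_apply {c d : ℕ × ℕ} (hcd : c ≠ d) (φ : Finset (ℕ × ℕ) → ℂ)
    (S : Finset (ℕ × ℕ)) : (modeOperator c * modeOperator d) φ S =
      if c ∈ S ∧ d ∈ S then modeSign c d * ((∏ x ∈ (S.erase c).erase d, modeSign c x) *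
        (∏ x ∈ (S.erase c).erase d, modeSign d x) * φ ((S.erase c).erase d)) else 0 := by
  rw [Module.End.mul_apply, modeOperator_apply, modeOperator_apply]
  by_cases hc : c ∈ S
  · by_cases hd : d ∈ S
    · have hd' : d ∈ S.erase c := Finset.mem_erase.2 ⟨hcd.symm, hd⟩
      rw [if_pos hc, if_pos hd', if_pos ⟨hc, hd⟩, ← Finset.mul_prod_erase _ _ hd']
      ring
    · simp [hd]
  · simp [hc]

/-- Modes in the same column anticommute and have square zero. -/
theorem modeOperator_anticomm {c d : ℕ × ℕ} (h : c.2 = d.2) :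
    modeOperator c * modeOperator d = -(modeOperator d * modeOperator c) := by
  by_cases hcd : c = d
  · subst hcd
    have : modeOperator c * modeOperator c = 0 := by
      ext φ S
      simp [Module.End.mul_apply, modeOperator_apply]
    rw [this, neg_zero]
  · ext φ S
    rw [LinearMap.neg_apply, Pi.neg_apply, modeOperator_mul_apply hcd,
      modeOperator_mul_apply (Ne.symm hcd), Finset.erase_right_comm]
    simp only [and_comm (a := c ∈ S)]
    have hs : modeSign c d = -modeSign d c := by
      have h1 : c.1 ≠ d.1 := fun h1 => hcd (Prod.ext h1 h)
      unfold modeSign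
      rcases lt_or_gt_of_ne h1 with h2 | h2
      · simp [h, h2, h2.le]
      · simp [h, h2, h2.le]
    split_ifs
    · rw [hs]; ring
    · simp

/-- Modes in different columns commute. -/
theorem modeOperator_comm {c d : ℕ × ℕ} (h : c.2 ≠ d.2) :
    modeOperator c * modeOperator d = modeOperator d * modeOperator c := by
  have hcd : c ≠ d := fun hcd => h (congrArg Prod.snd hcd)
  ext φ S
  rw [modeOperator_mul_apply hcd, modeOperator_mul_apply (Ne.symm hcd), Finset.erase_right_comm]
  simp only [and_comm (a := c ∈ S)]
  have hs : modeSign c d = modeSign d c := by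
    simp [modeSign, h, Ne.symm h]
  split_ifs
  · rw [hs]; ring
  · rfl

/-- If `b` and `c` anticommute, then `[b, c] = -2 c b` commutes with every element that commutes with
both or anticommutes with both. -/
theorem double_commutator_of_anticomm {A : Type*} [Ring A] {a b c : A} (hbc : b * c = -(c * b))
    (h : (a * b = -(b * a) ∧ a * c = -(c * a)) ∨ (a * b = b * a ∧ a * c = c * a)) :
    a * (b * c - c * b) = (b * c - c * b) * a := by
  have h1 : a * (c * b) = c * b * a := by
    rcases h with ⟨h1, h2⟩ | ⟨h1, h2⟩
    · rw [← mul_assoc, h2, neg_mul, mul_assoc, h1, mul_neg, neg_neg, mul_assoc]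
    · rw [← mul_assoc, h2, mul_assoc, h1, mul_assoc]
  rw [hbc, mul_sub, sub_mul, mul_neg, neg_mul, h1]

theorem modeOperator_double_commutator (a b c : ℕ × ℕ) :
    modeOperator a * (modeOperator b * modeOperator c - modeOperator c * modeOperator b) =
      (modeOperator b * modeOperator c - modeOperator c * modeOperator b) * modeOperator a := by
  by_cases hbc : b.2 = c.2
  · refine double_commutator_of_anticomm (modeOperator_anticomm hbc) ?_
    by_cases hab : a.2 = b.2
    · exact Or.inl ⟨modeOperator_anticomm hab, modeOperator_anticomm (hab.trans hbc)⟩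
    · exact Or.inr ⟨modeOperator_comm hab, modeOperator_comm (hbc ▸ hab)⟩
  · rw [modeOperator_comm hbc, sub_self, mul_zero, zero_mul]

/-- The sign of a word in the modes: one factor for each pair of positions. -/
noncomputable def wordSign {n : ℕ} (c : Fin n → ℕ × ℕ) : ℂ :=
  ∏ i, ∏ j ∈ Finset.Ioi i, modeSign (c i) (c j)

/-- A word in the creation operators, applied to the vacuum. -/
theorem prod_modeOperator_apply {n : ℕ} (c : Fin n → ℕ × ℕ) (S : Finset (ℕ × ℕ)) :
    (List.ofFn fun i => modeOperator (c i)).prod (Pi.single ∅ 1) S =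
      if Function.Injective c ∧ Finset.univ.image c = S then wordSign c else 0 := by
  induction n generalizing S with
  | zero =>
    have h1 : Function.Injective c := fun i => i.elim0
    simp [h1, wordSign, Pi.single_apply, eq_comm]
  | succ n ih =>
    rw [List.ofFn_succ, List.prod_cons, Module.End.mul_apply, modeOperator_apply,
      ih fun i => c i.succ]
    have himg : Finset.univ.image c = insert (c 0) (Finset.univ.image fun i => c (Fin.succ i)) := by
      ext x
      simp [Fin.exists_fin_succ, eq_comm]
    have hinj : Function.Injective c ↔
        (c 0 ∉ Finset.univ.image fun i => c (Fin.succ i)) ∧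
          Function.Injective fun i => c (Fin.succ i) := by
      conv_lhs => rw [← Fin.cons_self_tail c, Fin.cons_injective_iff]
      refine and_congr ?_ Iff.rfl
      simp [Fin.tail]
    have hsign : wordSign c = (∏ i : Fin n, modeSign (c 0) (c i.succ)) *
        wordSign fun i => c (Fin.succ i) := by
      rw [wordSign, Fin.prod_univ_succ, Fin.prod_Ioi_zero]
      congr 1
      exact Finset.prod_congr rfl fun i _ => Fin.prod_Ioi_succ _ _
    by_cases h : Function.Injective c ∧ Finset.univ.image c = S
    · obtain ⟨h1, rfl⟩ := h
      obtain ⟨h0, h2⟩ := hinj.1 h1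
      have he : (Finset.univ.image c).erase (c 0) = Finset.univ.image fun i => c (Fin.succ i) := by
        rw [himg, Finset.erase_insert h0]
      rw [if_pos (by simp), he, if_pos ⟨h2, rfl⟩, if_pos ⟨h1, rfl⟩, hsign,
        Finset.prod_image fun i _ j _ hij => h2 hij]
    · rw [if_neg h]
      split_ifs with h3 h4
      · refine absurd ⟨hinj.2 ⟨?_, h4.1⟩, ?_⟩ h
        · rw [h4.2]
          simp
        · rw [himg, h4.2, Finset.insert_erase h3]
      · simp
      · rfl

end FockSpace

/-! ### The sign of a tableau -/

section Sign

/-- The sign comparing two cells in the column reading order; it is `0` for equal cells, which makes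
it antisymmetric. -/
def lexSign (c d : ℕ × ℕ) : ℂ :=
  if c.2 < d.2 ∨ c.2 = d.2 ∧ c.1 < d.1 then 1 else if c = d then 0 else -1

theorem lexSign_antisymm (c d : ℕ × ℕ) : lexSign c d = -lexSign d c := by
  obtain ⟨a, b⟩ := c
  obtain ⟨a', b'⟩ := d
  simp only [lexSign, Prod.mk.injEq]
  split_ifs <;> first | omega | simp

theorem modeSign_eq_lexSign_mul {c d : ℕ × ℕ} (hcd : c ≠ d) :
    modeSign c d = lexSign c d * if d.2 < c.2 then -1 else 1 := by
  obtain ⟨a, b⟩ := c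
  obtain ⟨a', b'⟩ := d
  simp only [ne_eq, Prod.mk.injEq] at hcd
  simp only [modeSign, lexSign, Prod.mk.injEq]
  rcases lt_trichotomy b b' with h | h | h
  · simp [h, h.ne, h.not_gt]
  · subst h
    rcases lt_trichotomy a a' with h' | h' | h'
    · simp [h', h'.not_gt]
    · simp [h'] at hcd
    · simp [h', h'.ne', h'.not_gt]
  · simp [h, h.ne', h.not_gt]

/-- Permuting the entries of a word within the columns multiplies its sign by the sign of the
permutation: up to a factor that only depends on the columns, the sign of the word is that of the
permutation sorting it into column reading order. -/
theorem wordSign_comp {n : ℕ} {c : Fin n → ℕ × ℕ} (hc : Function.Injective c)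
    (q : Equiv.Perm (Fin n)) (hq : ∀ i, (c (q i)).2 = (c i).2) :
    wordSign (c ∘ q) = ((Equiv.Perm.sign q : ℤ) : ℂ) * wordSign c := by
  have h : ∀ c : Fin n → ℕ × ℕ, Function.Injective c → wordSign c =
      (∏ i, ∏ j ∈ Finset.Ioi i, lexSign (c i) (c j)) *
        ∏ i, ∏ j ∈ Finset.Ioi i, if (c j).2 < (c i).2 then -1 else 1 := by
    intro c hc
    simp only [wordSign, ← Finset.prod_mul_distrib]
    refine Finset.prod_congr rfl fun i _ => Finset.prod_congr rfl fun j hj => ?_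
    exact modeSign_eq_lexSign_mul (hc.ne (Finset.mem_Ioi.1 hj).ne)
  rw [h _ (hc.comp q.injective), h c hc, ← mul_assoc]
  simp only [Function.comp_apply, hq]
  congr 1
  exact q.prod_Ioi_comp_eq_sign_mul_prod (f := fun i j => lexSign (c i) (c j))
    fun i j => lexSign_antisymm _ _

end Sign

/-! ### A distinguished vector of the Specht module -/

section SpechtVector

variable {r : ℕ}

/-- The sign of a tableau: one factor `-1` for each pair of letters in a common column whose
order is opposite to the order of their rows. -/
noncomputable def tableauSign {μ : PartitionOf r} (T : Tableau μ) : ℂ :=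
  wordSign fun i => (T i).1

theorem tableauSign_perm {μ : PartitionOf r} {T : Tableau μ} {q : Equiv.Perm (Fin r)}
    (hq : q ∈ columnStabilizer T) :
    tableauSign (T.perm q) = ((Equiv.Perm.sign q : ℤ) : ℂ) * tableauSign T := by
  have h := wordSign_comp (c := fun i => (T i).1)
    (fun i j hij => T.injective (Subtype.ext hij)) q⁻¹
    (fun i => mem_columnStabilizer.1 (inv_mem_columnStabilizer hq) i)
  rw [Equiv.Perm.sign_inv] at h
  exact h

/-- The signed sum of the tabloids of all tableaux of shape `μ`. -/
noncomputable def spechtVector (μ : PartitionOf r) : (Fin r → ℕ) →₀ ℂ :=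
  ∑ T : Tableau μ, Finsupp.single (tabloid T) (tableauSign T)

theorem spechtVector_apply (μ : PartitionOf r) (f : Fin r → ℕ) :
    spechtVector μ f = ∑ T : Tableau μ with tabloid T = f, tableauSign T := by
  rw [spechtVector, Finsupp.finsetSum_apply, Finset.sum_filter]
  exact Finset.sum_congr rfl fun T _ => by rw [Finsupp.single_apply]

/-- Grouping the tableaux into orbits under the permutations of their columns writes
`spechtVector μ` as a combination of polytabloids. -/
theorem spechtVector_mem (μ : PartitionOf r) : spechtVector μ ∈ (specht μ).toSubmodule := by
  have h : spechtVector μ = ∑ T : Tableau μ,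
      (tableauSign T * ((columnStabilizer T).card : ℂ)⁻¹) • polytabloid T := by
    simp only [polytabloid, Finset.smul_sum, Finset.sum_sigma', spechtVector]
    -- each summand is distributed evenly over the column stabilizer before regrouping
    have h1 : ∀ T : Tableau μ, Finsupp.single (tabloid T) (tableauSign T) =
        ∑ _q ∈ columnStabilizer T, ((columnStabilizer T).card : ℂ)⁻¹ •
          Finsupp.single (tabloid T) (tableauSign T) := by
      intro T
      have h0 : ((columnStabilizer T).card : ℂ) ≠ 0 :=
        Nat.cast_ne_zero.2 (Finset.card_ne_zero_of_mem (one_mem_columnStabilizer T))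
      rw [Finset.sum_const, ← Nat.cast_smul_eq_nsmul ℂ, smul_smul, mul_inv_cancel₀ h0, one_smul]
    rw [Finset.sum_congr rfl fun T _ => h1 T, Finset.sum_sigma']
    refine Finset.sum_bij' (fun x _ => ⟨x.1.perm x.2⁻¹, x.2⟩) (fun x _ => ⟨x.1.perm x.2, x.2⟩)
      ?_ ?_ ?_ ?_ ?_
    · rintro ⟨T, q⟩ hq
      simp only [Finset.mem_sigma, Finset.mem_univ, true_and] at hq ⊢
      rwa [columnStabilizer_perm (inv_mem_columnStabilizer hq)]
    · rintro ⟨T, q⟩ hq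
      simp only [Finset.mem_sigma, Finset.mem_univ, true_and] at hq ⊢
      rwa [columnStabilizer_perm hq]
    · rintro ⟨T, q⟩ _
      simp only [perm_perm, mul_inv_cancel]
      rfl
    · rintro ⟨T, q⟩ _
      simp only [perm_perm, inv_mul_cancel]
      rfl
    · rintro ⟨T, q⟩ hq
      simp only [Finset.mem_sigma, Finset.mem_univ, true_and] at hq
      have hq' := inv_mem_columnStabilizer hq
      have hT : (T.perm q⁻¹).perm q = T := by
        rw [perm_perm, mul_inv_cancel]
        rfl
      rw [columnStabilizer_perm hq', tableauSign_perm hq', hT, Finsupp.smul_single,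
        Finsupp.smul_single, Equiv.Perm.sign_inv]
      congr 1
      simp only [smul_eq_mul]
      rcases Int.units_eq_one_or (Equiv.Perm.sign q) with h | h <;> simp [h, mul_comm]
  rw [h]
  exact Submodule.sum_mem _ fun T _ => Submodule.smul_mem _ _ (polytabloid_mem_specht T)

/-- At a weakly increasing assignment of the letters to the rows all signs are `+1`, and there is
no cancellation. -/
theorem spechtVector_ne_zero (μ : PartitionOf r) : spechtVector μ ≠ 0 := by
  obtain ⟨T₀⟩ := exists_tableau μ
  let σ := Tuple.sort (tabloid T₀)
  have hmono : Monotone (tabloid (T₀.perm σ⁻¹)) := by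
    have := Tuple.monotone_sort (tabloid T₀)
    have h : tabloid (T₀.perm σ⁻¹) = tabloid T₀ ∘ σ := by
      ext i
      simp [tabloid, perm_apply]
    rwa [h]
  intro h0
  have h1 := spechtVector_apply μ (tabloid (T₀.perm σ⁻¹))
  have h2 : ∀ T : Tableau μ, tabloid T = tabloid (T₀.perm σ⁻¹) → tableauSign T = 1 := by
    intro T hT
    rw [tableauSign, wordSign]
    refine Finset.prod_eq_one fun i _ => Finset.prod_eq_one fun j hj => ?_
    have hle : tabloid T i ≤ tabloid T j := by
      rw [hT]
      exact hmono (Finset.mem_Ioi.1 hj).le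
    rw [modeSign, if_neg]
    rintro ⟨-, hlt⟩
    exact absurd hlt (not_lt.2 hle)
  rw [Finset.sum_congr rfl fun T hT => h2 T (Finset.mem_filter.1 hT).2, h0] at h1
  simp only [Finsupp.coe_zero, Pi.zero_apply, Finset.sum_const, nsmul_eq_mul, mul_one] at h1
  have h3 := Nat.cast_eq_zero.1 h1.symm
  rw [Finset.card_eq_zero] at h3
  have h4 : T₀.perm σ⁻¹ ∈ (Finset.univ.filter fun T : Tableau μ =>
      tabloid T = tabloid (T₀.perm σ⁻¹)) := by simp
  rw [h3] at h4
  simp at h4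

end SpechtVector

/-! ### Green's ansatz and the maps from `PS(r)` to the Specht modules -/

section Evaluation

variable {r : ℕ}

/-- The universal property of `PS(V)` for an even space `V`. -/
noncomputable def evenLift {V A : Type*} [AddCommGroup V] [Module ℂ V] [Ring A] [Algebra ℂ A]
    (L : V →ₗ[ℂ] A) (hL : ∀ x y z, L x * (L y * L z - L z * L y) = (L y * L z - L z * L y) * L x) :
    PS (evenGrading V) →ₐ[ℂ] A :=
  RingQuot.liftAlgHom ℂ ⟨TensorAlgebra.lift ℂ L, by
    rintro _ _ ⟨hx, hy, hz⟩
    rename_i i j k x y z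
    have h0 : ∀ {i : ZMod 2} {x : V}, x ∈ evenGrading V i → i ≠ 0 → x = 0 := by
      intro i x hx hi
      simpa [evenGrading, hi] using hx
    simp only [superComm_map, TensorAlgebra.lift_ι_apply, map_zero]
    by_cases hi : i = 0
    · by_cases hj : j = 0
      · by_cases hk : k = 0
        · subst hi hj hk
          simp [superComm, hL]
        · simp [h0 hz hk, superComm]
      · simp [h0 hy hj, superComm]
    · simp [h0 hx hi, superComm]⟩

theorem evenLift_creation {V A : Type*} [AddCommGroup V] [Module ℂ V] [Ring A] [Algebra ℂ A]
    (L : V →ₗ[ℂ] A) (hL : ∀ x y z, L x * (L y * L z - L z * L y) = (L y * L z - L z * L y) * L x)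
    (x : V) : evenLift L hL (creation _ x) = L x := by
  simp [evenLift, creation]

/-- The parafermionic operator of a row: the sum of the creation operators of its cells. By the
commutation rules between the columns this is Green's ansatz. -/
noncomputable def rowOperator (μ : YoungDiagram) (k : ℕ) : Module.End ℂ (Finset (ℕ × ℕ) → ℂ) :=
  ∑ c ∈ μ.row k, modeOperator c

theorem double_commutator_sum {A ι κ ν : Type*} [Ring A] {s : Finset ι} {t : Finset κ}
    {u : Finset ν} {f : ι → A} {g : κ → A} {h : ν → A}
    (H : ∀ i ∈ s, ∀ j ∈ t, ∀ k ∈ u, f i * (g j * h k - h k * g j) =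
      (g j * h k - h k * g j) * f i) :
    (∑ i ∈ s, f i) * ((∑ j ∈ t, g j) * (∑ k ∈ u, h k) - (∑ k ∈ u, h k) * (∑ j ∈ t, g j)) =
      ((∑ j ∈ t, g j) * (∑ k ∈ u, h k) - (∑ k ∈ u, h k) * (∑ j ∈ t, g j)) * (∑ i ∈ s, f i) := by
  have h1 : (∑ j ∈ t, g j) * (∑ k ∈ u, h k) - (∑ k ∈ u, h k) * (∑ j ∈ t, g j) =
      ∑ j ∈ t, ∑ k ∈ u, (g j * h k - h k * g j) := by
    simp only [Finset.sum_sub_distrib, Finset.sum_mul_sum]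
    rw [Finset.sum_comm (s := u)]
  rw [h1]
  refine Commute.sum_left _ _ _ fun i hi => Commute.sum_right _ _ _ fun j hj =>
    Commute.sum_right _ _ _ fun k hk => H i hi j hj k hk

theorem rowOperator_double_commutator (μ : YoungDiagram) (k l m : ℕ) :
    rowOperator μ k * (rowOperator μ l * rowOperator μ m - rowOperator μ m * rowOperator μ l) =
      (rowOperator μ l * rowOperator μ m - rowOperator μ m * rowOperator μ l) *
        rowOperator μ k :=
  double_commutator_sum fun _ _ _ _ _ _ => modeOperator_double_commutator _ _ _

/-- The representation of `PS(ℂ^r)` on Fock space in which `a_i†` acts as the operator of the row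
`f i`. -/
noncomputable def rowEvaluation (μ : YoungDiagram) (f : Fin r → ℕ) :
    PSEven r →ₐ[ℂ] Module.End ℂ (Finset (ℕ × ℕ) → ℂ) :=
  evenLift (Fintype.linearCombination ℂ fun i => rowOperator μ (f i)) fun x y z => by
    simp only [Fintype.linearCombination_apply]
    refine double_commutator_sum fun i _ j _ k _ => ?_
    simp only [smul_mul_smul_comm, mul_comm (z k), ← smul_sub,
      rowOperator_double_commutator, mul_comm (x i)]

theorem rowEvaluation_gen (μ : YoungDiagram) (f : Fin r → ℕ) (i : Fin r) :
    rowEvaluation μ f (gen i) = rowOperator μ (f i) := by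
  rw [rowEvaluation, gen, evenLift_creation]
  simp [Fintype.linearCombination_apply, Pi.single_apply]

/-- The matrix coefficient of `rowEvaluation` between the vacuum and the state in which all cells
of `μ` are occupied. -/
noncomputable def rowCoefficient (μ : YoungDiagram) (f : Fin r → ℕ) : PSEven r →ₗ[ℂ] ℂ :=
  LinearMap.proj μ.cells ∘ₗ LinearMap.applyₗ (Pi.single ∅ (1 : ℂ)) ∘ₗ
    (rowEvaluation μ f).toLinearMap

/-- Expanding the row operators, a product of modes contributes only if it fills every cell of `μ`
once, that is, if it comes from a tableau. -/
theorem rowCoefficient_monomial (μ : PartitionOf r) (f : Fin r → ℕ) (τ : Equiv.Perm (Fin r)) :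
    rowCoefficient μ.1 f (multilinearMonomial τ) = spechtVector μ (f ∘ τ) := by
  classical
  have h1 : rowEvaluation μ.1 f (multilinearMonomial τ) =
      ∑ c ∈ Fintype.piFinset fun i => μ.1.row (f (τ i)),
        (List.ofFn fun i => modeOperator (c i)).prod := by
    rw [multilinearMonomial, map_list_prod, List.map_ofFn]
    simp only [Function.comp_def, rowEvaluation_gen, rowOperator]
    exact (MultilinearMap.mkPiAlgebraFin ℂ r _).map_sum_finset (fun _ c => modeOperator c)
      fun i => μ.1.row (f (τ i))
  have h2 : rowCoefficient μ.1 f (multilinearMonomial τ) =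
      ∑ c ∈ Fintype.piFinset fun i => μ.1.row (f (τ i)),
        if Function.Injective c ∧ Finset.univ.image c = μ.1.cells then wordSign c else 0 := by
    simp only [rowCoefficient, LinearMap.comp_apply, AlgHom.toLinearMap_apply, h1,
      LinearMap.applyₗ_apply_apply, LinearMap.sum_apply, LinearMap.proj_apply, Finset.sum_apply,
      prod_modeOperator_apply]
  rw [h2, spechtVector_apply, ← Finset.sum_filter]
  symm
  refine Finset.sum_bij (fun T _ i => (T i).1) ?_ ?_ ?_ ?_
  · intro T hT
    simp only [Finset.mem_filter, Finset.mem_univ, true_and] at hT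
    simp only [Finset.mem_filter, Fintype.mem_piFinset, YoungDiagram.mem_row_iff]
    refine ⟨fun i => ⟨(T i).2, congrFun hT i⟩, fun i j hij => T.injective (Subtype.ext hij), ?_⟩
    ext c
    simp only [Finset.mem_image, Finset.mem_univ, true_and]
    constructor
    · rintro ⟨i, rfl⟩
      exact (T i).2
    · intro hc
      exact ⟨T.symm ⟨c, hc⟩, by simp⟩
  · intro T _ T' _ h
    ext1 i
    exact Subtype.ext (congrFun h i)
  · intro c hc
    simp only [Finset.mem_filter, Fintype.mem_piFinset, YoungDiagram.mem_row_iff] at hc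
    obtain ⟨hrow, hinj, himg⟩ := hc
    let T : Tableau μ := Equiv.ofBijective (fun i => ⟨c i, (hrow i).1⟩) (by
      constructor
      · intro i j hij
        exact hinj (congrArg Subtype.val hij)
      · rintro ⟨x, hx⟩
        rw [← himg, Finset.mem_image] at hx
        obtain ⟨i, -, rfl⟩ := hx
        exact ⟨i, rfl⟩)
    exact ⟨T, Finset.mem_filter.2 ⟨Finset.mem_univ _, funext fun i => (hrow i).2⟩, rfl⟩
  · intro T _
    rfl

/-- The collection of the row coefficients over all tabloids of shape `μ`. -/
noncomputable def toTabloids (μ : PartitionOf r) : PSEven r →ₗ[ℂ] ((Fin r → ℕ) →₀ ℂ) :=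
  ∑ f ∈ Finset.univ.image (tabloid : Tableau μ → Fin r → ℕ),
    Finsupp.lsingle f ∘ₗ rowCoefficient μ.1 f

theorem toTabloids_monomial (μ : PartitionOf r) (τ : Equiv.Perm (Fin r)) :
    toTabloids μ (multilinearMonomial τ) = rowRep r τ (spechtVector μ) := by
  ext f
  rw [rowRep_apply, toTabloids, LinearMap.sum_apply, Finsupp.finsetSum_apply]
  simp only [LinearMap.comp_apply, Finsupp.lsingle_apply, rowCoefficient_monomial,
    Finsupp.single_apply, Finset.sum_ite_eq']
  split_ifs with hf
  · rfl
  · symm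
    rw [spechtVector_apply]
    refine Finset.sum_eq_zero fun T hT => absurd ?_ hf
    have hT' := (Finset.mem_filter.1 hT).2
    refine Finset.mem_image.2 ⟨T.perm τ, Finset.mem_univ _, funext fun i => ?_⟩
    have := congrFun hT' (τ⁻¹ i)
    simpa [tabloid, perm_apply] using this

theorem toTabloids_mem_specht (μ : PartitionOf r) :
    ∀ x ∈ (multilinearPart r).toSubmodule, toTabloids μ x ∈ (specht μ).toSubmodule := by
  intro x hx
  refine (Submodule.map_span_le (toTabloids μ) _ _).2 ?_ (Submodule.mem_map_of_mem hx)
  rintro _ ⟨τ, rfl⟩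
  rw [toTabloids_monomial]
  exact (specht μ).apply_mem_toSubmodule τ (spechtVector_mem μ)

theorem toTabloids_permRep (μ : PartitionOf r) (σ : Equiv.Perm (Fin r)) :
    ∀ x ∈ (multilinearPart r).toSubmodule,
      toTabloids μ (permRep r σ x) = rowRep r σ (toTabloids μ x) := by
  intro x hx
  refine Submodule.span_induction ?_ (by simp) ?_ ?_ hx
  · rintro _ ⟨τ, rfl⟩
    rw [permRep_multilinearMonomial, toTabloids_monomial, toTabloids_monomial, map_mul,
      Module.End.mul_apply]
  · intro x y _ _ hx hy
    rw [map_add, map_add, map_add, map_add, hx, hy]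
  · intro c x _ hx
    rw [map_smul, map_smul, map_smul, map_smul, hx]

/-- The equivariant map `PS(r) → S^μ` sending a monomial `a_{τ 1}† ⋯ a_{τ r}†` to
`τ · spechtVector μ`. -/
noncomputable def toSpecht (μ : PartitionOf r) :
    Representation.IntertwiningMap (multilinearPart r).toRepresentation
      (specht μ).toRepresentation where
  toLinearMap := (toTabloids μ).restrict (toTabloids_mem_specht μ)
  isIntertwining' σ := by
    ext x : 2
    exact toTabloids_permRep μ σ x.1 x.2

theorem toSpecht_ne_zero (μ : PartitionOf r) : toSpecht μ ≠ 0 := by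
  intro h
  have h1 : toTabloids μ (multilinearMonomial 1) = 0 :=
    congrArg Subtype.val (congrFun (congrArg DFunLike.coe h)
      (⟨multilinearMonomial 1, Submodule.subset_span ⟨1, rfl⟩⟩ :
        (multilinearPart r).toSubmodule))
  rw [toTabloids_monomial, map_one] at h1
  exact spechtVector_ne_zero μ h1

end Evaluation

/-! ### The dimension of the multilinear part -/

section SpanningSet

variable {r : ℕ}

theorem gen_double_commutator (i j k : Fin r) :
    (gen i : PSEven r) * (gen j * gen k - gen k * gen j) =
      (gen j * gen k - gen k * gen j) * gen i := by
  have h : ∀ i : Fin r, (Pi.single i 1 : Fin r → ℂ) ∈ evenGrading (Fin r → ℂ) 0 := fun i => by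
    simp [evenGrading]
  have h1 := creation_rel (evenGrading (Fin r → ℂ)) (h i) (h j) (h k)
  simp only [superComm, ZMod.val_zero, mul_zero, pow_zero, one_mul, add_zero] at h1
  exact sub_eq_zero.1 h1

/-- Moving a letter to the front of a word, when all commutators of letters are central. -/
theorem prod_map_mul_eq {A ι : Type*} [Ring A] [DecidableEq ι] (a : ι → A)
    (ha : ∀ i j k, a i * (a j * a k - a k * a j) = (a j * a k - a k * a j) * a i) (s : ι)
    (u : List ι) (hu : u.Nodup) :
    (u.map a).prod * a s = a s * (u.map a).prod +
      ∑ j ∈ u.toFinset, (a j * a s - a s * a j) * ((u.erase j).map a).prod := by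
  induction u with
  | nil => simp
  | cons i u ih =>
    obtain ⟨hi, hu'⟩ := List.nodup_cons.1 hu
    rw [List.toFinset_cons, Finset.sum_insert (by simpa using hi), List.erase_cons_head,
      List.map_cons, List.prod_cons, mul_assoc, ih hu', mul_add, Finset.mul_sum]
    have h1 : ∀ j ∈ u.toFinset, (a j * a s - a s * a j) * (((i :: u).erase j).map a).prod =
        a i * ((a j * a s - a s * a j) * ((u.erase j).map a).prod) := by
      intro j hj
      have hij : i ≠ j := by
        rintro rfl
        exact hi (by simpa using hj)
      rw [List.erase_cons_tail (by simpa using hij), List.map_cons, List.prod_cons, ← mul_assoc,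
        ← ha, mul_assoc]
    rw [Finset.sum_congr rfl h1]
    noncomm_ring

/-- The span of the monomials in which exactly the letters of `S` occur, each of them once. -/
noncomputable def multilinearSpan (S : Finset (Fin r)) : Submodule ℂ (PSEven r) :=
  Submodule.span ℂ {x | ∃ L : List (Fin r), L.Nodup ∧ L.toFinset = S ∧ x = (L.map gen).prod}

theorem prod_mem_multilinearSpan {L : List (Fin r)} (hL : L.Nodup) :
    (L.map gen).prod ∈ multilinearSpan L.toFinset :=
  Submodule.subset_span ⟨L, hL, rfl, rfl⟩

/-- The number of involutions (including the identity) fixing all letters outside `S`. -/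
def involutionCount (S : Finset (Fin r)) : ℕ :=
  (Finset.univ.filter fun σ : Equiv.Perm (Fin r) => σ * σ = 1 ∧ ∀ i ∉ S, σ i = i).card

/-- An involution supported on `S ∪ {s}` either fixes `s` or exchanges it with some `j ∈ S`. -/
theorem involutionCount_insert_le {s : Fin r} {S : Finset (Fin r)} (hs : s ∉ S) :
    involutionCount S + ∑ j ∈ S, involutionCount (S.erase j) ≤ involutionCount (insert s S) := by
  have hmaps : ∀ σ ∈ (Finset.univ.filter fun σ : Equiv.Perm (Fin r) =>
      σ * σ = 1 ∧ ∀ i ∉ insert s S, σ i = i), σ s ∈ insert s S := by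
    intro σ hσ
    simp only [Finset.mem_filter, Finset.mem_univ, true_and] at hσ
    by_contra h
    have h1 := hσ.2 _ h
    rw [σ.injective h1] at h
    exact h (Finset.mem_insert_self s S)
  rw [involutionCount.eq_def (insert s S), Finset.card_eq_sum_card_fiberwise hmaps,
    Finset.sum_insert hs]
  refine add_le_add ?_ (Finset.sum_le_sum fun j hj => ?_)
  · apply Finset.card_le_card
    intro σ hσ
    simp only [Finset.mem_filter, Finset.mem_univ, true_and] at hσ ⊢
    exact ⟨⟨hσ.1, fun i hi => hσ.2 i fun h => hi (Finset.mem_insert_of_mem h)⟩, hσ.2 s hs⟩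
  · have hsj : s ≠ j := by
      rintro rfl
      exact hs hj
    refine Finset.card_le_card_of_injOn (fun σ => Equiv.swap s j * σ) ?_
      fun σ _ τ _ h => mul_left_cancel h
    intro σ hσ
    simp only [Finset.coe_filter, Finset.mem_filter, Finset.mem_univ, true_and,
      Set.mem_ofPred_eq] at hσ ⊢
    obtain ⟨h2, hfix⟩ := hσ
    have hσs : σ s = s := hfix s fun h => hs (Finset.mem_of_mem_erase h)
    have hσj : σ j = j := hfix j (Finset.notMem_erase j S)
    have hcomm : Equiv.swap s j * σ = σ * Equiv.swap s j := by
      have := Equiv.mul_swap_eq_swap_mul σ s j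
      rw [hσs, hσj] at this
      exact this.symm
    refine ⟨⟨?_, fun i hi => ?_⟩, by simp [hσs]⟩
    · rw [mul_assoc, ← mul_assoc σ, ← hcomm, mul_assoc, h2, mul_one, Equiv.swap_mul_self]
    · rw [Finset.mem_insert, not_or] at hi
      rw [Equiv.Perm.mul_apply, hfix i fun h => hi.2 (Finset.mem_of_mem_erase h)]
      refine Equiv.swap_apply_of_ne_of_ne hi.1 ?_
      rintro rfl
      exact hi.2 hj

/-- The reordering step of the Poincaré–Birkhoff–Witt theorem: the letter `s` is either moved to
the front, or absorbed in a central commutator with another letter. -/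
theorem multilinearSpan_insert_le {s : Fin r} {S : Finset (Fin r)} (hs : s ∉ S)
    {N : Submodule ℂ (PSEven r)} (h1 : ∀ x ∈ multilinearSpan S, gen s * x ∈ N)
    (h2 : ∀ j ∈ S, ∀ x ∈ multilinearSpan (S.erase j), (gen j * gen s - gen s * gen j) * x ∈ N) :
    multilinearSpan (insert s S) ≤ N := by
  refine Submodule.span_le.2 ?_
  rintro _ ⟨L, hL, hLS, rfl⟩
  have hsL : s ∈ L := by
    rw [← List.mem_toFinset, hLS]
    exact Finset.mem_insert_self s S
  obtain ⟨u, v, rfl⟩ := List.append_of_mem hsL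
  have hperm : (s :: (u ++ v)).Nodup := List.perm_middle.nodup_iff.1 hL
  obtain ⟨hsuv, huv⟩ := List.nodup_cons.1 hperm
  have hS : (u ++ v).toFinset = S := by
    have h3 : (s :: (u ++ v)).toFinset = insert s S := by
      rw [← hLS]
      ext x
      simp only [List.mem_toFinset]
      exact List.perm_middle.symm.mem_iff
    rw [List.toFinset_cons] at h3
    have h4 : s ∉ (u ++ v).toFinset := by rwa [List.mem_toFinset]
    rw [← Finset.erase_insert h4, h3, Finset.erase_insert hs]
  rw [List.map_append, List.map_cons, List.prod_append, List.prod_cons, ← mul_assoc,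
    prod_map_mul_eq gen gen_double_commutator s u (List.Nodup.of_append_left huv), add_mul,
    Finset.sum_mul, mul_assoc, ← List.prod_append, ← List.map_append]
  refine N.add_mem (h1 _ ?_) (N.sum_mem fun j hj => ?_)
  · rw [← hS]
    exact prod_mem_multilinearSpan huv
  · have hju : j ∈ u := by simpa using hj
    have hjS : j ∈ S := by
      rw [← hS]
      simp [hju]
    rw [mul_assoc, ← List.prod_append, ← List.map_append, ← List.erase_append_left v hju]
    refine h2 j hjS _ ?_
    have : ((u ++ v).erase j).toFinset = S.erase j := by
      rw [← hS]
      ext x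
      rw [List.mem_toFinset, huv.mem_erase_iff, Finset.mem_erase, List.mem_toFinset]
    rw [← this]
    exact prod_mem_multilinearSpan (huv.erase j)

/-- The multilinear monomials in the letters of `S` are spanned by at most as many elements as there
are involutions supported on `S`: adding a letter `s` costs one copy of the spanning set of `S`, and
one of that of `S \ {j}` for each `j ∈ S`, as in `involutionCount_insert_le`. -/
theorem exists_spanning_multilinearSpan (S : Finset (Fin r)) :
    ∃ t : Finset (PSEven r), t.card ≤ involutionCount S ∧
      multilinearSpan S ≤ Submodule.span ℂ t := by
  classical
  induction S using Finset.strongInduction with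
  | H S ih =>
    rcases S.eq_empty_or_nonempty with rfl | ⟨s, hsS⟩
    · refine ⟨{1}, ?_, ?_⟩
      · rw [Finset.card_singleton, Nat.one_le_iff_ne_zero, involutionCount]
        exact Finset.card_ne_zero_of_mem (a := 1) (by simp)
      · refine Submodule.span_le.2 ?_
        rintro _ ⟨L, -, hL, rfl⟩
        rw [List.toFinset_eq_empty_iff] at hL
        subst hL
        exact Submodule.subset_span (by simp)
    · obtain ⟨S, hs, rfl⟩ : ∃ S', s ∉ S' ∧ insert s S' = S :=
        ⟨S.erase s, Finset.notMem_erase s S, Finset.insert_erase hsS⟩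
      obtain ⟨t₀, ht₀, hS₀⟩ := ih S (Finset.ssubset_insert hs)
      choose! t ht hS using fun j (hj : j ∈ S) =>
        ih (S.erase j) ((Finset.erase_ssubset hj).trans (Finset.ssubset_insert hs))
      have key : ∀ (b : PSEven r) (t' t'' : Finset (PSEven r)), (∀ y ∈ t', b * y ∈ t'') →
          ∀ x ∈ Submodule.span ℂ (t' : Set (PSEven r)),
            b * x ∈ Submodule.span ℂ (t'' : Set (PSEven r)) := by
        intro b t' t'' h x hx
        refine (Submodule.map_span_le (LinearMap.mulLeft ℂ b) _ _).2 ?_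
          (Submodule.mem_map_of_mem hx)
        exact fun y hy => Submodule.subset_span (h y hy)
      refine ⟨t₀.image (gen s * ·) ∪ S.biUnion fun j =>
        (t j).image ((gen j * gen s - gen s * gen j) * ·), ?_, ?_⟩
      · refine (Finset.card_union_le _ _).trans (le_trans ?_ (involutionCount_insert_le hs))
        refine add_le_add (Finset.card_image_le.trans ht₀) (Finset.card_biUnion_le.trans ?_)
        exact Finset.sum_le_sum fun j hj => Finset.card_image_le.trans (ht j hj)
      · refine multilinearSpan_insert_le hs ?_ ?_
        · intro x hx
          refine key _ t₀ _ (fun y hy => ?_) x (hS₀ hx)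
          exact Finset.mem_union_left _ (Finset.mem_image_of_mem _ hy)
        · intro j hj x hx
          refine key _ (t j) _ (fun y hy => ?_) x (hS j hj hx)
          exact Finset.mem_union_right _
            (Finset.mem_biUnion.2 ⟨j, hj, Finset.mem_image_of_mem _ hy⟩)

theorem multilinearPart_le_multilinearSpan :
    (multilinearPart r).toSubmodule ≤ multilinearSpan Finset.univ := by
  refine Submodule.span_le.2 ?_
  rintro _ ⟨τ, rfl⟩
  refine Submodule.subset_span ⟨List.ofFn τ, List.nodup_ofFn.2 τ.injective, ?_, ?_⟩
  · ext i
    simp only [List.mem_toFinset, List.mem_ofFn, Finset.mem_univ, iff_true]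
    exact τ.surjective i
  · rw [List.map_ofFn, multilinearMonomial]
    rfl

instance finiteDimensional_multilinearPart :
    FiniteDimensional ℂ (multilinearPart r).toSubmodule :=
  FiniteDimensional.span_of_finite ℂ (Set.finite_range _)

theorem finrank_multilinearPart_le :
    Module.finrank ℂ (multilinearPart r).toSubmodule ≤
      Nat.card {σ : Equiv.Perm (Fin r) // σ * σ = 1} := by
  obtain ⟨t, ht, hle⟩ := exists_spanning_multilinearSpan (Finset.univ : Finset (Fin r))
  calc Module.finrank ℂ (multilinearPart r).toSubmodule
      ≤ Module.finrank ℂ (Submodule.span ℂ (t : Set (PSEven r))) :=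
        Submodule.finrank_mono (multilinearPart_le_multilinearSpan.trans hle)
    _ ≤ t.card := finrank_span_finset_le_card t
    _ ≤ _ := ht
    _ = _ := by
      rw [Nat.card_eq_fintype_card, Fintype.card_subtype, involutionCount]
      simp

end SpanningSet

/-! ### Multiplicity-free sums of irreducible representations -/

section MultiplicityFree

open Representation

variable {G : Type*} [Group G] {ι : Type*} [Fintype ι] [DecidableEq ι]
  {V : ι → Type*} [∀ i, AddCommGroup (V i)] [∀ i, Module ℂ (V i)]
  {ρ : ∀ i, Representation ℂ G (V i)}
  {P : Type*} [AddCommGroup P] [Module ℂ P] {π : Representation ℂ G P}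

/-- The map into a finite direct sum with given components. -/
def toDirectSum (f : ∀ i, IntertwiningMap π (ρ i)) : IntertwiningMap π (directSum ρ) where
  toLinearMap := ∑ i, DirectSum.lof ℂ ι V i ∘ₗ (f i).toLinearMap
  isIntertwining' g := by
    ext x i
    simp only [LinearMap.comp_apply, LinearMap.sum_apply, map_sum, directSum_apply,
      DirectSum.lmap_lof, IntertwiningMap.toLinearMap_apply, IntertwiningMap.isIntertwining]

theorem toDirectSum_apply (f : ∀ i, IntertwiningMap π (ρ i)) (x : P) (i : ι) :
    toDirectSum f x i = f i x := by
  have h : toDirectSum f x = ∑ j, DirectSum.lof ℂ ι V j (f j x) := by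
    change (∑ i, DirectSum.lof ℂ ι V i ∘ₗ (f i).toLinearMap) x = _
    simp [LinearMap.sum_apply]
  rw [h, DFinsupp.finsetSum_apply, Finset.sum_eq_single i]
  · exact DirectSum.of_eq_same i _
  · intro j _ hj
    exact DirectSum.of_eq_of_ne j i _ hj.symm
  · simp

/-- In a multiplicity-free direct sum, the only copy of `ρ i` is the common kernel of the
projections to the other summands. -/
theorem existsUnique_subrepresentation [FiniteDimensional ℂ P] [∀ i, (ρ i).IsIrreducible]
    (hρ : ∀ i j, Nonempty ((ρ i).Equiv (ρ j)) → i = j) {f : ∀ i, IntertwiningMap π (ρ i)}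
    (hf : Function.Bijective (toDirectSum f)) (i : ι) :
    ∃! U : Subrepresentation π, Nonempty (U.toRepresentation.Equiv (ρ i)) := by
  let K : Subrepresentation π :=
    { toSubmodule := ⨅ j, ⨅ _ : j ≠ i, LinearMap.ker (f j).toLinearMap
      apply_mem_toSubmodule := by
        intro g v hv
        simp only [Submodule.mem_iInf, LinearMap.mem_ker, IntertwiningMap.toLinearMap_apply,
          IntertwiningMap.isIntertwining] at hv ⊢
        intro j hj
        rw [hv j hj, map_zero] }
  have hK : ∀ v, v ∈ K.toSubmodule ↔ ∀ j, j ≠ i → f j v = 0 := by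
    intro v
    simp only [K, Submodule.mem_iInf, LinearMap.mem_ker, IntertwiningMap.toLinearMap_apply]
  let p : IntertwiningMap K.toRepresentation (ρ i) :=
    { toLinearMap := (f i).toLinearMap ∘ₗ K.toSubmodule.subtype
      isIntertwining' := fun g => by
        ext v
        exact IntertwiningMap.isIntertwining _ _ (f i) g v }
  have hp : Function.Bijective p := by
    constructor
    · intro v w hvw
      apply Subtype.ext
      apply hf.1
      ext j
      rw [toDirectSum_apply, toDirectSum_apply]
      by_cases hj : j = i
      · subst hj
        exact hvw
      · rw [(hK v).1 v.2 j hj, (hK w).1 w.2 j hj]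
    · intro z
      obtain ⟨v, hv⟩ := hf.2 (DirectSum.of V i z)
      have hvj : ∀ j, f j v = DirectSum.of V i z j := fun j => by rw [← hv, toDirectSum_apply]
      refine ⟨⟨v, (hK v).2 fun j hj => ?_⟩, ?_⟩
      · rw [hvj, DirectSum.of_eq_of_ne i j _ hj]
      · exact (hvj i).trans (DirectSum.of_eq_same i z)
  refine ⟨K, ⟨p.ofBijective hp⟩, ?_⟩
  rintro U ⟨e⟩
  have hle : U.toSubmodule ≤ K.toSubmodule := by
    intro u hu
    refine (hK u).2 fun j hj => ?_
    let q : IntertwiningMap (ρ i) (ρ j) :=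
      { toLinearMap := (f j).toLinearMap ∘ₗ U.toSubmodule.subtype ∘ₗ e.symm.toLinearMap
        isIntertwining' := fun g => by
          ext v
          have h1 : e.symm (ρ i g v) = U.toRepresentation g (e.symm v) :=
            IntertwiningMap.isIntertwining _ _ e.symm.toIntertwiningMap g v
          exact (congrArg (fun x : U.toSubmodule => f j x) h1).trans
            (IntertwiningMap.isIntertwining _ _ (f j) g _) }
    have hq : q = 0 := by
      refine (IsIrreducible.bijective_or_eq_zero q).resolve_left fun h => hj ?_
      exact (hρ i j ⟨q.ofBijective h⟩).symm
    have h2 : f j (e.symm (e ⟨u, hu⟩)).1 = 0 :=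
      congrFun (congrArg DFunLike.coe hq) (e ⟨u, hu⟩)
    rwa [Representation.Equiv.symm_apply_apply] at h2
  apply Subrepresentation.toSubmodule_injective
  refine Submodule.eq_of_le_of_finrank_eq hle ?_
  rw [e.toLinearEquiv.finrank_eq, (p.ofBijective hp).toLinearEquiv.finrank_eq]

variable [Fintype G] [∀ i, FiniteDimensional ℂ (V i)] [∀ i, (ρ i).IsIrreducible]
  (hρ : ∀ i j, Nonempty ((ρ i).Equiv (ρ j)) → i = j)

include hρ in
/-- Nonzero equivariant maps to pairwise nonisomorphic irreducible representations are jointly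
surjective, since the operators attached to the characters separate the targets. -/
theorem toDirectSum_surjective {f : ∀ i, IntertwiningMap π (ρ i)} (hf : ∀ i, f i ≠ 0) :
    Function.Surjective (toDirectSum f) := by
  have h : LinearMap.range (toDirectSum f).toLinearMap = ⊤ := by
    rw [eq_top_iff]
    intro y _
    induction y using DirectSum.induction_on with
    | zero => exact Submodule.zero_mem _
    | add x y hx hy => exact Submodule.add_mem _ (hx trivial) (hy trivial)
    | of i z =>
      obtain ⟨c, hc0, hc⟩ := charOperator_self (ρ i)
      obtain ⟨v, hv⟩ := ((IsIrreducible.surjective_or_eq_zero (f i)).resolve_right (hf i))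
        (c⁻¹ • z)
      refine ⟨charOperator (ρ i) π v, ?_⟩
      ext j
      change toDirectSum f _ j = _
      rw [toDirectSum_apply, map_charOperator]
      by_cases hij : i = j
      · subst hij
        rw [hc, hv, DirectSum.of_eq_same]
        simp [smul_smul, hc0]
      · rw [charOperator_eq_zero (ρ i) (ρ j) ⟨fun e => hij (hρ i j ⟨e⟩)⟩,
          DirectSum.of_eq_of_ne i j _ (Ne.symm hij)]
        rfl
  exact LinearMap.range_eq_top.1 h

variable [FiniteDimensional ℂ P]

include hρ in
theorem toDirectSum_bijective {f : ∀ i, IntertwiningMap π (ρ i)} (hf : ∀ i, f i ≠ 0)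
    (hdim : Module.finrank ℂ P ≤ ∑ i, Module.finrank ℂ (V i)) :
    Function.Bijective (toDirectSum f) := by
  have hsurj := toDirectSum_surjective hρ hf
  have hd : Module.finrank ℂ P = Module.finrank ℂ (DirectSum ι V) := by
    refine le_antisymm ?_ ?_
    · rwa [Module.finrank_directSum]
    · exact LinearMap.finrank_le_finrank_of_surjective (f := (toDirectSum f).toLinearMap) hsurj
  exact ⟨(LinearMap.injective_iff_surjective_of_finrank_eq_finrank
    (f := (toDirectSum f).toLinearMap) hd).2 hsurj, hsurj⟩

end MultiplicityFree

/-! ### The decomposition of the multilinear part -/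

section Decomposition

variable {r : ℕ}

noncomputable instance fintypePartitionOf : Fintype (PartitionOf r) := Fintype.ofFinite _

theorem card_conjClasses_le_card (r : ℕ) :
    Nat.card (ConjClasses (Equiv.Perm (Fin r))) ≤ Fintype.card (PartitionOf r) := by
  rw [← Nat.card_eq_fintype_card]
  exact card_conjClasses_le r

theorem sum_finrank_specht (r : ℕ) :
    ∑ μ : PartitionOf r, Module.finrank ℂ (specht μ).toSubmodule =
      Nat.card {g : Equiv.Perm (Fin r) // g * g = 1} := by
  have h := sum_finrank_eq_card_involutions (G := Equiv.Perm (Fin r))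
    (V := fun μ : PartitionOf r => (specht μ).toSubmodule)
    (fun μ : PartitionOf r => (specht μ).toRepresentation)
    (fun _ _ => eq_of_equiv_specht) (card_conjClasses_le_card r)
  exact h fun μ => exists_form_specht μ

theorem finrank_multilinearPart_le_sum (r : ℕ) :
    Module.finrank ℂ (multilinearPart r).toSubmodule ≤
      ∑ μ : PartitionOf r, Module.finrank ℂ (specht μ).toSubmodule := by
  rw [sum_finrank_specht]
  exact finrank_multilinearPart_le

/-- The map from `PS(r)` to the direct sum of all Specht modules with components `toSpecht`. -/
noncomputable def toSpechtSum (r : ℕ) [DecidableEq (PartitionOf r)] :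
    Representation.IntertwiningMap (multilinearPart r).toRepresentation
      (Representation.directSum fun μ : PartitionOf r => (specht μ).toRepresentation) :=
  toDirectSum (V := fun μ : PartitionOf r => (specht μ).toSubmodule)
    (ρ := fun μ => (specht μ).toRepresentation) (P := (multilinearPart r).toSubmodule)
    (π := (multilinearPart r).toRepresentation) toSpecht

theorem toSpechtSum_bijective [DecidableEq (PartitionOf r)] :
    Function.Bijective (toSpechtSum r) := by
  have h := toDirectSum_bijective (V := fun μ : PartitionOf r => (specht μ).toSubmodule)
    (ρ := fun μ => (specht μ).toRepresentation) (P := (multilinearPart r).toSubmodule)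
    (π := (multilinearPart r).toRepresentation) (fun _ _ => eq_of_equiv_specht) (f := toSpecht)
  have h1 := h toSpecht_ne_zero
  exact h1 (finrank_multilinearPart_le_sum r)

theorem exists_equiv_specht {W : Type*} [AddCommGroup W] [Module ℂ W] [FiniteDimensional ℂ W]
    (ρ : Representation ℂ (Equiv.Perm (Fin r)) W) [ρ.IsIrreducible] :
    ∃ μ : PartitionOf r, Nonempty (ρ.Equiv (specht μ).toRepresentation) :=
  exists_equiv_of_isIrreducible (V := fun μ : PartitionOf r => (specht μ).toSubmodule)
    (fun μ => (specht μ).toRepresentation) (fun _ _ => eq_of_equiv_specht)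
    (card_conjClasses_le_card r) ρ

theorem existsUnique_subrepresentation_multilinearPart (μ : PartitionOf r) :
    ∃! U : Subrepresentation (multilinearPart r).toRepresentation,
      Nonempty (U.toRepresentation.Equiv (specht μ).toRepresentation) := by
  classical
  have h := existsUnique_subrepresentation (V := fun μ : PartitionOf r => (specht μ).toSubmodule)
    (ρ := fun μ => (specht μ).toRepresentation) (P := (multilinearPart r).toSubmodule)
    (π := (multilinearPart r).toRepresentation) (fun _ _ => eq_of_equiv_specht) (f := toSpecht)
  have h1 := h toSpechtSum_bijective
  exact h1 μ

end Decomposition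

end Parastatistics

theorem mainTheorem5 (r : ℕ) :
    -- the modules `S^μ`, `μ ⊢ r`, are irreducible, and `PS(r)` is isomorphic to their direct sum
    (∀ μ : Parastatistics.PartitionOf r,
      Representation.IsIrreducible (k := ℂ) (V := (Parastatistics.specht μ).toSubmodule)
        (Parastatistics.specht μ).toRepresentation) ∧
    Nonempty ((Parastatistics.multilinearPart r).toRepresentation.Equiv
      (Representation.directSum fun μ : Parastatistics.PartitionOf r =>
        (Parastatistics.specht μ).toRepresentation)) ∧
    -- every irreducible finite-dimensional representation of `𝔖_r` is isomorphic to exactly one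
    -- `S^μ`, and occurs in `PS(r)` exactly once
    (∀ (W : Type*) [AddCommGroup W] [Module ℂ W] [FiniteDimensional ℂ W]
        (ρ : Representation ℂ (Equiv.Perm (Fin r)) W), ρ.IsIrreducible →
      (∃! μ : Parastatistics.PartitionOf r,
        Nonempty (ρ.Equiv (Parastatistics.specht μ).toRepresentation)) ∧
      (∃! U : Subrepresentation (Parastatistics.multilinearPart r).toRepresentation,
        Nonempty (U.toRepresentation.Equiv ρ))) := by
  classical
  refine ⟨Parastatistics.isIrreducible_specht,
    ⟨Representation.IntertwiningMap.ofBijective _ Parastatistics.toSpechtSum_bijective⟩,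
    fun W _ _ _ ρ hW => ?_⟩
  obtain ⟨μ, ⟨e⟩⟩ := Parastatistics.exists_equiv_specht ρ
  obtain ⟨U, ⟨eU⟩, hU⟩ := Parastatistics.existsUnique_subrepresentation_multilinearPart μ
  exact ⟨⟨μ, ⟨e⟩, fun ν ⟨e'⟩ => Parastatistics.eq_of_equiv_specht ⟨e'.symm.trans e⟩⟩,
    U, ⟨eU.trans e.symm⟩, fun U' ⟨e'⟩ => hU U' ⟨e'.trans e⟩⟩
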